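/- **Setting.** Fix $T>0$, a Lipschitz function $\psi:\mathbb R^2\to\mathbb R$ and a bounded Lipschitz function $\phi:\mathbb R^4\to\mathbb R$. Graphs are locally finite with a countable vertex set; loops are allowed. A *network* $N=(G,\mu,\omega,\theta(0))$ is a graph $G=(V,E)$ with edge weights $\mu_e\in(0,\infty)$, $e\in E$, and vertex marks $(\omega_v,\theta_v(0))\in\mathbb R\times\mathbb R$, $v\in V$. Put $\mu_{uv}=\mu_{\{u,v\}}$ if $\{u,v\}\in E$, $\mu_{uv}=0$ otherwise, and $\mu_v=\sum_u\mu_{uv}$. A *rooted network* $(N,o)$ is a network with a distinguished vertex $o$; $(N,o)_r$ is the sub-network induced by the vertices at graph distance at most $r$ from $o$, and $\partial (G,o)_r$ is the set of its vertices that have a neighbour in $G$ outside it. Let $\mathcal N^*$ be the set of classes $[N,o]$ of rooted networks up to rooted isomorphism (a bijection of the vertices preserving root, edges and marks), $\mathcal N^*_f\subset\mathcal N^*$ the classes of finite ones, and $\mathcal C^*$ the analogous set of classes of rooted networks $(G,\mu,\omega,\alpha)$ with vertex marks $(\omega_v,\alpha_v)\in\mathbb R\times C([0,T];\mathbb R)$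 instead of $(\omega_v,\theta_v(0))$. Both carry the topology and Borel $\sigma$-algebra of the local (pseudo)distance $$d([N,o],[N',o'])=\inf\Big\{\tfrac1{1+r}+\delta\Big\},$$ the infimum being over $r\in\mathbb N$, $\delta>0$ for which there is a rooted graph isomorphism $(N,o)_r\to(N',o')_r$ such that corresponding vertex and edge marks are at distance less than $\delta$ ($\inf\emptyset=\infty$). The set $\mathcal P(\mathcal C^*)$ of Borel probability measures on $\mathcal C^*$ carries the topology of weak convergence. A rooted network $(N,o)$ is *nice* if there is $a>0$ with $|\partial(G,o)_r|\le ae^{ar}$ for all integers $r\ge1$, and there are $0<c\le C<\infty$ with $c\le\mu_e\le C$ for all $e\in E$. Let $\mathcal B^*\subset\mathcal N^*$ be the set of classes of nice rooted networks. Given i.i.d. standard Brownian motions $(B_v)_{v\in V}$ on a probability space, consider for $v\in V$, $t\in[0,T]$ the system $$d\theta_v(t)=\frac1{\mu_v}\sum_{u\in V}\mu_{uv}\,\phi(\theta_u(t),\theta_v(t);\omega_v,\omega_u)\,dt+\psi(\theta_v(t);\omega_v)\,dt+dB_v(t)\qquad(\ast)$$ with initial conditions $\theta(0)$, where the first term is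 $0$ if $\mu_v=0$. A *strong solution* is a family of processes $(\theta_v)_{v\in V}$ with paths in $C([0,T];\mathbb R)$, adapted to the filtration generated by the Brownian motions and the null sets, that almost surely satisfies $(\ast)$ in integrated form. For a strong solution $\theta^N$, let $N^\theta=(G,\mu,\omega,\theta^N)$. For finite $N$, $\Theta([N,o])\in\mathcal P(\mathcal C^*)$ denotes the law of $[N^\theta,o]$. **Theorem 5.9 (Extension of $\Theta$).** 1. For every nice rooted network $(N,o)$ and all i.i.d. standard Brownian motions $(B_v)_{v\in V}$ on a probability space, the (possibly infinite) system $(\ast)$ has a strong solution $\theta^N$, and it is unique: any two strong solutions driven by $(B_v)_{v\in V}$ almost surely coincide. Moreover, if $\theta^{(r)}$ is the strong solution of the system of the finite network $(N,o)_r$ driven by the same Brownian motions, then almost surely $\theta^{(r)}_v\to\theta^N_v$ uniformly on $[0,T]$ as $r\to\infty$, for every vertex $v$ in the connected component of $o$ (for every $v\in V$ if $N$ is connected). 2. $\mathcal N^*_f\subset\mathcal B^*$, and there is a continuous transition kernel $\overline\Theta:\mathcal B^*\to\mathcal P(\mathcal C^*)$ (a continuous map with $x\mapsto\overline\Theta(x)(A)$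 measurable for all Borel sets $A$) that extends $\Theta$ and such that, for every nice rooted network $(N,o)$, $\overline\Theta([N,o])$ is the law of $[N^\theta,o]$; this law does not depend on the representative of the class $[N,o]$ or on the probability space. -/

import Mathlib

open MeasureTheory ProbabilityTheory Filter Topology
open scoped NNReal ENNReal

universe u

/-! ### Networks

A network is a locally finite graph (loops are allowed, no multiple edges) with marks in `Υ`
on its vertices and marks in `Ξ` on its edges. -/

/-- A network with vertex set `V`, vertex marks in `Υ` and edge marks in `Ξ`.  The mark of the
unoriented edge `{x, y}` is `emark x y h`, where `h : Adj x y`. -/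
structure Network (V Υ Ξ : Type) where
  Adj : V → V → Prop
  symm : ∀ {x y : V}, Adj x y → Adj y x
  locFin : ∀ x : V, {y : V | Adj x y}.Finite
  vmark : V → Υ
  emark : ∀ x y : V, Adj x y → Ξ
  emark_symm : ∀ (x y : V) (h : Adj x y), emark y x (symm h) = emark x y h

namespace Network

variable {V Υ Ξ : Type}

/-- The sub-network induced by a set `H` of vertices. -/
def induce (N : Network V Υ Ξ) (H : Set V) : Network H Υ Ξ where
  Adj x y := N.Adj x y
  symm h := N.symm h
  locFin x := (N.locFin x).preimage Subtype.val_injective.injOn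
  vmark x := N.vmark x
  emark x y h := N.emark x y h
  emark_symm x y h := N.emark_symm x y h

/-- The vertices at graph distance at most `r` from `o`.  (`SimpleGraph.fromRel` only forgets the
loops, which do not matter for distances.) -/
def ball (N : Network V Υ Ξ) (o : V) (r : ℕ) : Set V :=
  {v | (SimpleGraph.fromRel N.Adj).edist o v ≤ r}

/-- The boundary of a set `H` of vertices: the vertices of `H` with a neighbour outside `H`. -/
def boundary (N : Network V Υ Ξ) (H : Set V) : Set V :=
  {v | v ∈ H ∧ ∃ w, w ∉ H ∧ N.Adj v w}

/-- The neighbours of a vertex. -/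
noncomputable def nbrs (N : Network V Υ Ξ) (v : V) : Finset V := (N.locFin v).toFinset

theorem mem_ball_zero (N : Network V Υ Ξ) (o v : V) : v ∈ N.ball o 0 ↔ v = o := by
  rw [show v ∈ N.ball o 0 ↔ (SimpleGraph.fromRel N.Adj).edist o v ≤ ((0 : ℕ) : ℕ∞) from Iff.rfl,
    Nat.cast_zero, nonpos_iff_eq_zero, SimpleGraph.edist_eq_zero_iff, eq_comm]

theorem mem_ball_succ (N : Network V Υ Ξ) (o v : V) (r : ℕ) :
    v ∈ N.ball o (r + 1) ↔ v ∈ N.ball o r ∨ ∃ w ∈ N.ball o r, N.Adj w v := by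
  constructor
  · intro h
    have hne : (SimpleGraph.fromRel N.Adj).edist v o ≠ ⊤ := by
      rw [SimpleGraph.edist_comm]
      exact ne_top_of_le_ne_top (ENat.natCast_ne_top (r + 1)) h
    obtain ⟨p, hp⟩ := SimpleGraph.exists_walk_of_edist_ne_top hne
    rw [SimpleGraph.edist_comm] at hp
    have hlen : p.length ≤ r + 1 := by
      have h' : ((p.length : ℕ) : ℕ∞) ≤ ((r + 1 : ℕ) : ℕ∞) := hp ▸ h
      exact_mod_cast h'
    cases p with
    | nil => left; simp [ball]
    | cons hadj q =>
      right
      rename_i w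
      refine ⟨w, ?_, ?_⟩
      · change (SimpleGraph.fromRel N.Adj).edist o w ≤ r
        rw [SimpleGraph.edist_comm]
        refine (SimpleGraph.edist_le q).trans ?_
        simp only [SimpleGraph.Walk.length_cons] at hlen
        exact_mod_cast (by omega : q.length ≤ r)
      · rw [SimpleGraph.fromRel_adj] at hadj
        exact hadj.2.elim N.symm id
  · rintro (h | ⟨w, hw, hadj⟩)
    · exact le_trans (show (SimpleGraph.fromRel N.Adj).edist o v ≤ r from h)
        (by exact_mod_cast Nat.le_succ r)
    · change (SimpleGraph.fromRel N.Adj).edist o v ≤ ((r + 1 : ℕ) : ℕ∞)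
      refine (SimpleGraph.edist_triangle (v := w)).trans ?_
      have h1 : (SimpleGraph.fromRel N.Adj).edist w v ≤ 1 := by
        by_cases hwv : w = v
        · subst hwv; simp
        · have ha : (SimpleGraph.fromRel N.Adj).Adj w v := by
            rw [SimpleGraph.fromRel_adj]; exact ⟨hwv, Or.inl hadj⟩
          simpa using SimpleGraph.edist_le ha.toWalk
      push_cast
      exact add_le_add hw h1

theorem root_mem_ball (N : Network V Υ Ξ) (o : V) (r : ℕ) : o ∈ N.ball o r := by
  simp [ball]

theorem ball_mono (N : Network V Υ Ξ) (o : V) {s r : ℕ} (h : s ≤ r) :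
    N.ball o s ⊆ N.ball o r := fun v hv =>
  le_trans (show (SimpleGraph.fromRel N.Adj).edist o v ≤ s from hv) (by exact_mod_cast h)

theorem ball_finite (N : Network V Υ Ξ) (o : V) (r : ℕ) : (N.ball o r).Finite := by
  induction r with
  | zero => exact (Set.finite_singleton o).subset fun v hv => (N.mem_ball_zero o v).1 hv
  | succ r ih =>
    refine (ih.union (ih.biUnion fun w _ => N.locFin w)).subset fun v hv => ?_
    rcases (N.mem_ball_succ o v r).1 hv with h | ⟨w, hw, ha⟩
    · exact Or.inl h
    · exact Or.inr (Set.mem_biUnion hw ha)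

end Network

/-! ### Rooted networks, isomorphisms and the local distance -/

/-- A network on a countable vertex set, with a distinguished vertex. -/
structure RootedNetwork (Υ Ξ : Type) : Type 1 where
  V : Type
  countable : Countable V
  net : Network V Υ Ξ
  root : V

namespace RootedNetwork

variable {Υ Ξ : Type}

/-- The rooted ball `(N, o)_r`: the sub-network induced by the vertices at distance at most `r`
from the root. -/
def restrict (N : RootedNetwork Υ Ξ) (r : ℕ) : RootedNetwork Υ Ξ where
  V := N.net.ball N.root r
  countable := by have := N.countable; infer_instance
  net := N.net.induce (N.net.ball N.root r)
  root := ⟨N.root, N.net.root_mem_ball N.root r⟩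

/-- Rooted isomorphism of rooted networks: a bijection of the vertices that maps root to root and
preserves edges and marks. -/
def Iso (N N' : RootedNetwork Υ Ξ) : Prop :=
  ∃ f : N.V ≃ N'.V, f N.root = N'.root ∧
    (∀ x y, N.net.Adj x y ↔ N'.net.Adj (f x) (f y)) ∧
    (∀ x, N'.net.vmark (f x) = N.net.vmark x) ∧
    ∀ x y (h : N.net.Adj x y) (h' : N'.net.Adj (f x) (f y)),
      N'.net.emark (f x) (f y) h' = N.net.emark x y h

/-- There is a rooted isomorphism of the underlying rooted graphs under which corresponding marks
are at distance less than `δ`. -/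
def CloseIso [MetricSpace Υ] [MetricSpace Ξ] (δ : ℝ) (N N' : RootedNetwork Υ Ξ) : Prop :=
  ∃ f : N.V ≃ N'.V, f N.root = N'.root ∧
    (∀ x y, N.net.Adj x y ↔ N'.net.Adj (f x) (f y)) ∧
    (∀ x, dist (N.net.vmark x) (N'.net.vmark (f x)) < δ) ∧
    ∀ x y (h : N.net.Adj x y) (h' : N'.net.Adj (f x) (f y)),
      dist (N.net.emark x y h) (N'.net.emark (f x) (f y) h') < δ

/-- The pair `(r, δ)` is good for `N`, `N'`. -/
def Good [MetricSpace Υ] [MetricSpace Ξ] (r : ℕ) (δ : ℝ) (N N' : RootedNetwork Υ Ξ) : Prop :=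
  CloseIso δ (N.restrict r) (N'.restrict r)

/-- The local distance `inf {1 / (1 + r) + δ : (r, δ) is good}`.  It takes values in `[0, ∞]`: the
infimum of the empty set is `∞`, which happens when exactly one of the two roots has a loop. -/
noncomputable def localDist [MetricSpace Υ] [MetricSpace Ξ] (N N' : RootedNetwork Υ Ξ) : ℝ≥0∞ :=
  ⨅ (r : ℕ) (δ : ℝ) (_ : 0 < δ) (_ : Good r δ N N'), ENNReal.ofReal (1 / (1 + (r : ℝ)) + δ)

theorem Iso.refl (N : RootedNetwork Υ Ξ) : Iso N N :=
  ⟨Equiv.refl _, rfl, fun _ _ => Iff.rfl, fun _ => rfl, fun _ _ _ _ => rfl⟩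

theorem Iso.symm {N N' : RootedNetwork Υ Ξ} (h : Iso N N') : Iso N' N := by
  obtain ⟨f, h0, h1, h2, h3⟩ := h
  refine ⟨f.symm, by simp [← h0], fun x y => by simp [h1], fun x => by simp [← h2], ?_⟩
  intro x y h h'
  obtain ⟨a, rfl⟩ := f.surjective x
  obtain ⟨b, rfl⟩ := f.surjective y
  have e := h3 a b ((h1 a b).2 h) h
  rw [e]
  congr 1 <;> simp

theorem Iso.trans {N N' N'' : RootedNetwork Υ Ξ} (h : Iso N N') (k : Iso N' N'') :
    Iso N N'' := by
  obtain ⟨f, h0, h1, h2, h3⟩ := h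
  obtain ⟨g, k0, k1, k2, k3⟩ := k
  refine ⟨f.trans g, by simp [h0, k0], fun x y => ?_, fun x => ?_, fun x y a b => ?_⟩
  · simp [h1 x y, k1]
  · simp [k2, h2]
  · exact (k3 (f x) (f y) ((h1 x y).1 a) b).trans (h3 x y a _)

/-- Rooted networks up to rooted isomorphism. -/
instance isoSetoid (Υ Ξ : Type) : Setoid (RootedNetwork Υ Ξ) where
  r := Iso
  iseqv := ⟨Iso.refl, Iso.symm, Iso.trans⟩

/-- An isomorphism between two graphs that both are induced on sets containing the balls of
radius `s` preserves these balls. -/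
theorem map_ball {V V' : Type} {N : Network V Υ Ξ} {N' : Network V' Υ Ξ} {o : V} {o' : V'}
    {A : Set V} {A' : Set V'} (f : A → A') {s : ℕ} (hA : N.ball o s ⊆ A) (ho : o ∈ A)
    (h0 : (f ⟨o, ho⟩ : V') = o') (h1 : ∀ x y : A, N.Adj x y → N'.Adj (f x) (f y)) :
    ∀ (v : V) (hv : v ∈ N.ball o s), (f ⟨v, hA hv⟩ : V') ∈ N'.ball o' s := by
  induction s with
  | zero =>
    intro v hv
    have hvo := (N.mem_ball_zero o v).1 hv
    subst hvo
    rw [N'.mem_ball_zero]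
    exact h0
  | succ s ih =>
    intro v hv
    have hA' : N.ball o s ⊆ A := (N.ball_mono o (Nat.le_succ s)).trans hA
    rw [N'.mem_ball_succ]
    rcases (N.mem_ball_succ o v s).1 hv with h | ⟨w, hw, ha⟩
    · exact Or.inl (ih hA' v h)
    · exact Or.inr ⟨_, ih hA' w hw, h1 ⟨w, hA' hw⟩ ⟨v, hA hv⟩ ha⟩

section LocalDist

variable [MetricSpace Υ] [MetricSpace Ξ]

theorem CloseIso.symm {δ : ℝ} {N N' : RootedNetwork Υ Ξ} (h : CloseIso δ N N') :
    CloseIso δ N' N := by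
  obtain ⟨f, h0, h1, h2, h3⟩ := h
  refine ⟨f.symm, by simp [← h0], fun x y => by simp [h1], fun x => ?_, ?_⟩
  · have := h2 (f.symm x)
    rwa [f.apply_symm_apply, dist_comm] at this
  intro x y h h'
  obtain ⟨a, rfl⟩ := f.surjective x
  obtain ⟨b, rfl⟩ := f.surjective y
  have e := h3 a b ((h1 a b).2 h) h
  rw [dist_comm]
  convert e using 2
  congr 1 <;> simp

theorem CloseIso.trans {δ ε : ℝ} {N N' N'' : RootedNetwork Υ Ξ} (h : CloseIso δ N N')
    (k : CloseIso ε N' N'') : CloseIso (δ + ε) N N'' := by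
  obtain ⟨f, h0, h1, h2, h3⟩ := h
  obtain ⟨g, k0, k1, k2, k3⟩ := k
  refine ⟨f.trans g, by simp [h0, k0], fun x y => ?_, fun x => ?_, fun x y a b => ?_⟩
  · simp [h1 x y, k1]
  · exact (dist_triangle _ _ _).trans_lt (add_lt_add (h2 x) (k2 (f x)))
  · exact (dist_triangle _ _ _).trans_lt
      (add_lt_add (h3 x y a ((h1 x y).1 a)) (k3 (f x) (f y) ((h1 x y).1 a) b))

theorem Iso.closeIso {δ : ℝ} (hδ : 0 < δ) {N N' : RootedNetwork Υ Ξ} (h : Iso N N') :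
    CloseIso δ N N' := by
  obtain ⟨f, h0, h1, h2, h3⟩ := h
  refine ⟨f, h0, h1, fun x => by rw [h2, dist_self]; exact hδ, fun x y a b => ?_⟩
  rw [h3 x y a b, dist_self]; exact hδ

theorem CloseIso.restrict_of_subset {δ : ℝ} {N N' : RootedNetwork Υ Ξ} {A : Set N.V}
    {A' : Set N'.V} {s : ℕ} (hA : N.net.ball N.root s ⊆ A) (hA' : N'.net.ball N'.root s ⊆ A')
    (f : A ≃ A')
    (h0 : f ⟨N.root, hA (N.net.root_mem_ball _ _)⟩ = ⟨N'.root, hA' (N'.net.root_mem_ball _ _)⟩)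
    (h1 : ∀ x y : A, N.net.Adj x y ↔ N'.net.Adj (f x) (f y))
    (h2 : ∀ x : A, dist (N.net.vmark x) (N'.net.vmark (f x)) < δ)
    (h3 : ∀ (x y : A) (h : N.net.Adj x y) (h' : N'.net.Adj (f x) (f y)),
      dist (N.net.emark x y h) (N'.net.emark (f x) (f y) h') < δ) :
    Good s δ N N' := by
  have m1 := map_ball (N := N.net) (N' := N'.net) (o' := N'.root) (fun x => f x) hA
    (hA (N.net.root_mem_ball _ _)) (by rw [h0]) (fun x y => (h1 x y).1)
  have m2 := map_ball (N := N'.net) (N' := N.net) (o' := N.root) (fun x => f.symm x) hA'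
    (hA' (N'.net.root_mem_ball _ _)) (by rw [← h0, f.symm_apply_apply])
    (fun x y h => (h1 _ _).2 (by simpa using h))
  let g : N.net.ball N.root s ≃ N'.net.ball N'.root s :=
    { toFun := fun v => ⟨f ⟨v, hA v.2⟩, m1 v v.2⟩
      invFun := fun v => ⟨f.symm ⟨v, hA' v.2⟩, m2 v v.2⟩
      left_inv := fun v => by simp
      right_inv := fun v => by simp }
  refine ⟨g, ?_, fun x y => h1 ⟨x.1, hA x.2⟩ ⟨y.1, hA y.2⟩, fun x => h2 ⟨x.1, hA x.2⟩,
    fun x y h h' => h3 ⟨x.1, hA x.2⟩ ⟨y.1, hA y.2⟩ h h'⟩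
  apply Subtype.ext
  exact congrArg (fun z : A' => (z : N'.V)) h0

theorem Good.mono {r s : ℕ} (hs : s ≤ r) {δ : ℝ} {N N' : RootedNetwork Υ Ξ}
    (h : Good r δ N N') : Good s δ N N' := by
  obtain ⟨f, h0, h1, h2, h3⟩ := h
  exact CloseIso.restrict_of_subset (N.net.ball_mono _ hs) (N'.net.ball_mono _ hs) f h0 h1 h2 h3

theorem CloseIso.good {δ : ℝ} {N N' : RootedNetwork Υ Ξ} (h : CloseIso δ N N') (r : ℕ) :
    Good r δ N N' := by
  obtain ⟨f, h0, h1, h2, h3⟩ := h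
  refine CloseIso.restrict_of_subset (A := Set.univ) (A' := Set.univ) (Set.subset_univ _)
    (Set.subset_univ _)
    ((Equiv.Set.univ _).trans (f.trans (Equiv.Set.univ _).symm)) ?_ (fun x y => h1 _ _)
    (fun x => h2 _) (fun x y h h' => h3 _ _ _ _)
  apply Subtype.ext
  exact h0

theorem localDist_le {r : ℕ} {δ : ℝ} (hδ : 0 < δ) {N N' : RootedNetwork Υ Ξ}
    (h : Good r δ N N') : localDist N N' ≤ ENNReal.ofReal (1 / (1 + (r : ℝ)) + δ) :=
  iInf_le_of_le r (iInf_le_of_le δ (iInf_le_of_le hδ (iInf_le_of_le h le_rfl)))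

theorem localDist_comm (N N' : RootedNetwork Υ Ξ) : localDist N N' = localDist N' N := by
  have key : ∀ N N' : RootedNetwork Υ Ξ, localDist N N' ≤ localDist N' N := fun N N' =>
    le_iInf fun r => le_iInf fun δ => le_iInf fun hδ => le_iInf fun h =>
      localDist_le hδ (CloseIso.symm h)
  exact le_antisymm (key _ _) (key _ _)

theorem localDist_triangle (N N' N'' : RootedNetwork Υ Ξ) :
    localDist N N'' ≤ localDist N N' + localDist N' N'' := by
  have e : localDist N N' + localDist N' N'' =
      ⨅ (r : ℕ) (δ : ℝ) (_ : 0 < δ) (_ : Good r δ N N'),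
        (ENNReal.ofReal (1 / (1 + (r : ℝ)) + δ) + localDist N' N'') := by
    simp only [localDist, ENNReal.iInf_add]
  rw [e]
  refine le_iInf fun r => le_iInf fun δ => le_iInf fun hδ => le_iInf fun h => ?_
  have e' : ENNReal.ofReal (1 / (1 + (r : ℝ)) + δ) + localDist N' N'' =
      ⨅ (s : ℕ) (ε : ℝ) (_ : 0 < ε) (_ : Good s ε N' N''),
        (ENNReal.ofReal (1 / (1 + (r : ℝ)) + δ) + ENNReal.ofReal (1 / (1 + (s : ℝ)) + ε)) := by
    simp only [localDist, ENNReal.add_iInf]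
  rw [e']
  refine le_iInf fun s => le_iInf fun ε => le_iInf fun hε => le_iInf fun k => ?_
  have hg : Good (min r s) (δ + ε) N N'' :=
    CloseIso.trans (h.mono (min_le_left r s)) (k.mono (min_le_right r s))
  refine (localDist_le (by positivity) hg).trans ?_
  rw [← ENNReal.ofReal_add (by positivity) (by positivity)]
  apply ENNReal.ofReal_le_ofReal
  have p1 : (0 : ℝ) ≤ 1 / (1 + (r : ℝ)) := by positivity
  have p2 : (0 : ℝ) ≤ 1 / (1 + (s : ℝ)) := by positivity
  rcases le_total r s with hrs | hrs
  · rw [min_eq_left hrs]; linarith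
  · rw [min_eq_right hrs]; linarith

theorem localDist_eq_zero_of_iso {N N' : RootedNetwork Υ Ξ} (h : Iso N N') :
    localDist N N' = 0 := by
  refine le_antisymm (ENNReal.le_of_forall_pos_le_add fun ε hε _ => ?_) (zero_le)
  have hε' : (0 : ℝ) < ε := hε
  obtain ⟨n, hn⟩ := exists_nat_one_div_lt (half_pos hε')
  rw [zero_add]
  refine (localDist_le (half_pos hε') ((Iso.closeIso (half_pos hε') h).good n)).trans ?_
  rw [ENNReal.ofReal_le_iff_le_toReal ENNReal.coe_ne_top, ENNReal.coe_toReal, add_comm (1 : ℝ)]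
  linarith

theorem localDist_congr {N M N' M' : RootedNetwork Υ Ξ} (h : Iso N M) (h' : Iso N' M') :
    localDist N N' = localDist M M' := by
  have key : ∀ {N M N' M' : RootedNetwork Υ Ξ}, Iso N M → Iso N' M' →
      localDist N N' ≤ localDist M M' := by
    intro N M N' M' h h'
    calc localDist N N' ≤ localDist N M + (localDist M M' + localDist M' N') :=
          (localDist_triangle _ _ _).trans (add_le_add le_rfl (localDist_triangle _ _ _))
      _ = localDist M M' := by
          rw [localDist_eq_zero_of_iso h, localDist_eq_zero_of_iso h'.symm, zero_add, add_zero]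
  exact le_antisymm (key h h') (key h.symm h'.symm)

end LocalDist

end RootedNetwork

/-- The space of rooted networks up to rooted isomorphism. -/
def NetworkClass (Υ Ξ : Type) : Type 1 := Quotient (RootedNetwork.isoSetoid Υ Ξ)

/-- The class `[N, o]` of a rooted network. -/
def RootedNetwork.cls {Υ Ξ : Type} (N : RootedNetwork Υ Ξ) : NetworkClass Υ Ξ :=
  Quotient.mk _ N

/-- The local topology on isomorphism classes of rooted networks is the one of the local
distance.  (The graphs are not required to be connected; a rooted network is at distance `0` from
the connected component of its root.) -/
noncomputable instance NetworkClass.instPseudoEMetricSpace (Υ Ξ : Type) [MetricSpace Υ]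
    [MetricSpace Ξ] : PseudoEMetricSpace (NetworkClass Υ Ξ) where
  edist := Quotient.lift₂ RootedNetwork.localDist
    fun _ _ _ _ h h' => RootedNetwork.localDist_congr h h'
  edist_self := by
    rintro ⟨N⟩
    exact RootedNetwork.localDist_eq_zero_of_iso (RootedNetwork.Iso.refl N)
  edist_comm := by
    rintro ⟨N⟩ ⟨N'⟩
    exact RootedNetwork.localDist_comm N N'
  edist_triangle := by
    rintro ⟨N⟩ ⟨N'⟩ ⟨N''⟩
    exact RootedNetwork.localDist_triangle N N' N''

noncomputable instance NetworkClass.instMeasurableSpace (Υ Ξ : Type) [MetricSpace Υ] [MetricSpace Ξ] :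
    MeasurableSpace (NetworkClass Υ Ξ) := borel _

instance NetworkClass.instBorelSpace (Υ Ξ : Type) [MetricSpace Υ] [MetricSpace Ξ] :
    BorelSpace (NetworkClass Υ Ξ) := ⟨rfl⟩

/-! ### The networks of the model -/

/-- The open half-line `(0, ∞)` of edge weights. -/
abbrev Weight : Type := Set.Ioi (0 : ℝ)

/-- The space `C([0, T]; ℝ)` with the uniform distance. -/
abbrev PathSpace (T : ℝ) : Type := C(Set.Icc (0 : ℝ) T, ℝ)

/-- Vertex marks of the initial networks: `(ω_v, θ_v(0))`. -/
abbrev StateMark : Type := ℝ × ℝ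

/-- Vertex marks of the trajectory networks: `(ω_v, α_v)` with `α_v ∈ C([0, T]; ℝ)`. -/
abbrev PathMark (T : ℝ) : Type := ℝ × PathSpace T

namespace Network

variable {V : Type}

open Classical in
/-- The weight matrix: `μ_{vw}` is the weight of the edge `{v, w}`, and `0` if there is none. -/
noncomputable def weight (N : Network V StateMark Weight) (v w : V) : ℝ :=
  if h : N.Adj v w then (N.emark v w h : ℝ) else 0

/-- The total weight `μ_v = ∑_w μ_{vw}`; only the neighbours of `v` contribute. -/
noncomputable def totalWeight (N : Network V StateMark Weight) (v : V) : ℝ :=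
  ∑ w ∈ N.nbrs v, N.weight v w

/-- The drift of the coordinate `v` in the configuration `y`:
`μ_v⁻¹ ∑_w μ_{vw} φ(y_w, y_v; ω_v, ω_w) + ψ(y_v; ω_v)`.  If `μ_v = 0` then `v` has no neighbours and
the first term is `0`. -/
noncomputable def drift (N : Network V StateMark Weight) (ψ : ℝ × ℝ → ℝ)
    (φ : ℝ × ℝ × ℝ × ℝ → ℝ) (y : V → ℝ) (v : V) : ℝ :=
  1 / N.totalWeight v *
      ∑ w ∈ N.nbrs v, N.weight v w * φ (y w, y v, (N.vmark v).1, (N.vmark w).1) +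
    ψ (y v, (N.vmark v).1)

/-- Replace the initial conditions by the trajectories `α`. -/
def withPaths {T : ℝ} (N : Network V StateMark Weight) (α : V → PathSpace T) :
    Network V (PathMark T) Weight where
  Adj := N.Adj
  symm := N.symm
  locFin := N.locFin
  vmark v := ((N.vmark v).1, α v)
  emark := N.emark
  emark_symm := N.emark_symm

end Network

namespace RootedNetwork

/-- The rooted network `(N^α, o)` with the trajectories `α` as marks. -/
def withPaths {T : ℝ} (N : RootedNetwork StateMark Weight) (α : N.V → PathSpace T) :
    RootedNetwork (PathMark T) Weight where
  V := N.V
  countable := N.countable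
  net := N.net.withPaths α
  root := N.root

/-- Nice rooted networks: the boundaries of the balls around the root grow at most exponentially
and the edge weights are bounded away from `0` and `∞` (which holds trivially if there are no
edges). -/
def IsNice (N : RootedNetwork StateMark Weight) : Prop :=
  (∃ a : ℝ, 0 < a ∧ ∀ r : ℕ, 1 ≤ r →
    ((N.net.boundary (N.net.ball N.root r)).ncard : ℝ) ≤ a * Real.exp (a * r)) ∧
  ∃ c C : ℝ, 0 < c ∧ ∀ (x y : N.V) (h : N.net.Adj x y),
    c ≤ (N.net.emark x y h : ℝ) ∧ (N.net.emark x y h : ℝ) ≤ C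

end RootedNetwork

/-- The set of classes of nice rooted networks. -/
def niceClasses : Set (NetworkClass StateMark Weight) :=
  {x | ∃ N : RootedNetwork StateMark Weight, N.cls = x ∧ N.IsNice}

/-- The set of classes of finite rooted networks. -/
def finiteClasses : Set (NetworkClass StateMark Weight) :=
  {x | ∃ N : RootedNetwork StateMark Weight, N.cls = x ∧ Finite N.V}

/-! ### Interacting diffusions -/

section Diffusions

variable {V : Type} {Ω : Type u}

/-- `(B_v)_{v ∈ V}` are i.i.d. standard Brownian motions. -/
structure IsBrownianFamily [MeasurableSpace Ω] (B : V → ℝ≥0 → Ω → ℝ) (P : Measure Ω) : Prop where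
  measurable : ∀ v t, Measurable (B v t)
  brownian : ∀ v, IsBrownianReal (B v) P
  indep : iIndepFun (fun v ω t => B v t ω) P

/-- The σ-algebra generated by the Brownian motions up to time `t`. -/
abbrev pastSigma (B : V → ℝ≥0 → Ω → ℝ) (t : ℝ) : MeasurableSpace Ω :=
  ⨆ (v : V) (s : ℝ≥0) (_ : (s : ℝ) ≤ t), MeasurableSpace.comap (B v s) inferInstance

/-- `θ` is a strong solution on `[0, T]`, driven by the Brownian motions `B`, of the system
`dθ_v = (μ_v⁻¹ ∑_w μ_{vw} φ(θ_w, θ_v; ω_v, ω_w) + ψ(θ_v; ω_v)) dt + dB_v` with the initial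
conditions of the network: it has continuous trajectories, is adapted to the filtration generated
by `B` and the null sets, and almost surely satisfies the integral equations. -/
structure IsStrongSolution [MeasurableSpace Ω] {T : ℝ} (hT : 0 ≤ T) (ψ : ℝ × ℝ → ℝ)
    (φ : ℝ × ℝ × ℝ × ℝ → ℝ) (N : Network V StateMark Weight) (B : V → ℝ≥0 → Ω → ℝ)
    (P : Measure Ω) (θ : Ω → V → PathSpace T) : Prop where
  adapted : ∀ (v : V) (t : Set.Icc (0 : ℝ) T), ∃ g : Ω → ℝ,
    Measurable[pastSigma B t] g ∧ (fun ω => θ ω v t) =ᵐ[P] g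
  equation : ∀ᵐ ω ∂P, ∀ (v : V) (t : Set.Icc (0 : ℝ) T),
    θ ω v t = (N.vmark v).2 +
      (∫ s in (0 : ℝ)..t, N.drift ψ φ (fun w => Set.IccExtend hT (θ ω w) s) v) +
      B v ⟨t, t.2.1⟩ ω

end Diffusions

/-- `Q` is the law of the random class `[N^θ, o]`, where `[N, o] = x` and `θ` is the system of
interacting diffusions on `N`: for every representative of `x`, every family of i.i.d. Brownian
motions and every strong solution `θ` driven by it. -/
def IsDiffusionLaw {T : ℝ} (hT : 0 ≤ T) (ψ : ℝ × ℝ → ℝ) (φ : ℝ × ℝ × ℝ × ℝ → ℝ)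
    (x : NetworkClass StateMark Weight)
    (Q : ProbabilityMeasure (NetworkClass (PathMark T) Weight)) : Prop :=
  ∀ N : RootedNetwork StateMark Weight, N.cls = x →
    ∀ (Ω : Type u) [MeasurableSpace Ω] (P : Measure Ω) [IsProbabilityMeasure P]
      (B : N.V → ℝ≥0 → Ω → ℝ) (_ : IsBrownianFamily B P) (θ : Ω → N.V → PathSpace T)
      (_ : IsStrongSolution hT ψ φ N.net B P θ),
      AEMeasurable (fun ω => (N.withPaths (θ ω)).cls) P ∧
      P.map (fun ω => (N.withPaths (θ ω)).cls) =
        (Q : Measure (NetworkClass (PathMark T) Weight))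

/-! The system is solved pathwise. For fixed continuous driving paths it is an integral equation,
and its solution is a deterministic functional `Network.flow` of these paths. Everything rests on
one stability estimate, `Network.ConvergesAlong.tendsto_solution`.

Let networks converge locally to `N` and let their drivers converge vertex by vertex. Since φ is
bounded, the interaction terms at a vertex differ by at most `2 * M` whatever the neighbours do.
Hence the solutions at `v` eventually differ by at most a constant times `exp (l * s)`, with the
same constant for all `v`. With `K` the sum of the Lipschitz constants and `l = 2 * K + 1`, a bound
`c * exp (l * s)` at `v` and its neighbours improves to half of itself plus an error that depends
only on the data near `v` and vanishes in the limit, so eventually to `3 / 4 * c`. Each improvement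
consults the neighbours once more, but as `c` is common to all vertices it can be repeated any
number of times. The interaction is averaged with weights of total mass at most one, so degrees do
not enter the constants.

Applied to a constant sequence of networks, the estimate gives pathwise uniqueness, continuity of
the flow, and dependence of the solution at time `t` on the drivers up to `t` only, hence
adaptedness. Applied to the balls around the root, it gives the convergence of the finite systems.
Existence is a Picard iteration in two stages.

For the kernel, convergence of classes provides near-isomorphisms of growing balls. One Brownian
family indexed by `N.V ⊕ ℕ` drives all networks at once, with corresponding vertices sharing their
motion. The coupled solutions then converge for every outcome, so the laws converge weakly
(`RootedNetwork.tendsto_diffusionLaw`). Invariance under isomorphism follows from this continuity.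
The coupling needs a Brownian family to exist, which Lévy's series provides, and its law to be
unique, which makes the law of the flow independent of the probability space. -/

/-! ### Estimates with exponential weights in time -/

/-- If the integrands differ by at most `A + K c e^{λ s}`, where `λ = 2 K + 1`, then the integrals
over `[0, t]` differ by at most `A t + (c / 2) e^{λ t}`. -/
theorem abs_integral_sub_le_of_exp_bound {f g : ℝ → ℝ} (hf : Continuous f) (hg : Continuous g)
    {A K c t : ℝ} (hK : 0 ≤ K) (hc : 0 ≤ c) (ht : 0 ≤ t)
    (h : ∀ s ∈ Set.Icc 0 t, |f s - g s| ≤ A + K * (c * Real.exp ((2 * K + 1) * s))) :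
    |(∫ s in (0 : ℝ)..t, f s) - ∫ s in (0 : ℝ)..t, g s| ≤
      A * t + c / 2 * Real.exp ((2 * K + 1) * t) := by
  have hl : (0 : ℝ) < 2 * K + 1 := by linarith
  rw [← intervalIntegral.integral_sub (hf.intervalIntegrable _ _) (hg.intervalIntegrable _ _)]
  have h1 : |∫ s in (0 : ℝ)..t, (f s - g s)| ≤
      ∫ s in (0 : ℝ)..t, (A + K * (c * Real.exp ((2 * K + 1) * s))) := by
    rw [← Real.norm_eq_abs]
    refine intervalIntegral.norm_integral_le_of_norm_le ht ?_
      (Continuous.intervalIntegrable (by fun_prop) _ _)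
    exact Eventually.of_forall fun s hs => h s ⟨hs.1.le, hs.2⟩
  refine h1.trans ?_
  have h2 : ∫ s in (0 : ℝ)..t, (A + K * (c * Real.exp ((2 * K + 1) * s))) =
      A * t + K * (c * ((Real.exp ((2 * K + 1) * t) - 1) / (2 * K + 1))) := by
    rw [intervalIntegral.integral_add (Continuous.intervalIntegrable (by fun_prop) _ _)
      (Continuous.intervalIntegrable (by fun_prop) _ _), intervalIntegral.integral_const,
      intervalIntegral.integral_const_mul, intervalIntegral.integral_const_mul,
      intervalIntegral.integral_comp_mul_left (fun s => Real.exp s) hl.ne', integral_exp]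
    simp [smul_eq_mul]
    ring
  rw [h2]
  have h3 : K * (c * ((Real.exp ((2 * K + 1) * t) - 1) / (2 * K + 1))) =
      (K / (2 * K + 1)) * (c * (Real.exp ((2 * K + 1) * t) - 1)) := by ring
  -- The rate `2 * K + 1` is chosen for this: integration in time gains a factor below one half over
  -- the Lipschitz constant.
  have h4 : K / (2 * K + 1) ≤ 1 / 2 := by rw [div_le_div_iff₀ hl two_pos]; linarith
  have h5 : (0 : ℝ) ≤ Real.exp ((2 * K + 1) * t) - 1 :=
    sub_nonneg.2 (Real.one_le_exp (by positivity))
  have h6 := mul_le_mul_of_nonneg_right h4 (mul_nonneg hc h5)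
  rw [h3]
  nlinarith [mul_nonneg hc h5]

/-- A quantity that improves every bound `f ≤ k E` to `f ≤ (A + k / 2) E` is at most `2 A E`. -/
theorem le_of_half_improving {ι : Type*} {f E : ι → ℝ} {A c : ℝ} (hA : 0 ≤ A) (hc : 0 ≤ c)
    (hE : ∀ i, 0 ≤ E i) (h0 : ∀ i, f i ≤ c * E i)
    (h : ∀ k, 0 ≤ k → (∀ i, f i ≤ k * E i) → ∀ i, f i ≤ (A + k / 2) * E i) (i : ι) :
    f i ≤ 2 * A * E i := by
  have key : ∀ n : ℕ, ∀ i, f i ≤ (2 * A + c * (1 / 2) ^ n) * E i := by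
    intro n
    induction n with
    | zero => exact fun i => (h0 i).trans (mul_le_mul_of_nonneg_right (by linarith) (hE i))
    | succ n ih =>
      intro i
      refine (h _ (by positivity) ih i).trans (le_of_eq ?_)
      rw [pow_succ]; ring
  have hlim : Tendsto (fun n : ℕ => (2 * A + c * (1 / 2 : ℝ) ^ n) * E i) atTop
      (𝓝 ((2 * A + c * 0) * E i)) :=
    ((tendsto_pow_atTop_nhds_zero_of_lt_one (by norm_num) (by norm_num)).const_mul c
      |>.const_add _).mul_const _
  have := ge_of_tendsto' hlim fun n => key n i
  simpa using this

/-! ### Estimates for the drift -/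

namespace Network

section Drift

variable {V : Type} (N : Network V StateMark Weight)

@[simp]
theorem mem_nbrs {v w : V} : w ∈ N.nbrs v ↔ N.Adj v w := by simp [nbrs]

/-- The transition probabilities `μ_{vw} / μ_v` of the weighted random walk. -/
noncomputable def transition (v w : V) : ℝ := N.weight v w / N.totalWeight v

theorem weight_nonneg (v w : V) : 0 ≤ N.weight v w := by
  unfold weight
  split_ifs with h
  · exact (N.emark v w h).2.le
  · exact le_rfl

theorem weight_pos {v w : V} (h : N.Adj v w) : 0 < N.weight v w := by
  unfold weight
  rw [dif_pos h]
  exact (N.emark v w h).2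

theorem totalWeight_nonneg (v : V) : 0 ≤ N.totalWeight v :=
  Finset.sum_nonneg fun w _ => N.weight_nonneg v w

theorem totalWeight_pos {v w : V} (h : N.Adj v w) : 0 < N.totalWeight v :=
  Finset.sum_pos' (fun w _ => N.weight_nonneg v w) ⟨w, N.mem_nbrs.2 h, N.weight_pos h⟩

theorem transition_nonneg (v w : V) : 0 ≤ N.transition v w :=
  div_nonneg (N.weight_nonneg v w) (N.totalWeight_nonneg v)

/-- Only an inequality: at a vertex without neighbours the sum is empty, otherwise it is one. -/
theorem sum_transition_le_one (v : V) : ∑ w ∈ N.nbrs v, N.transition v w ≤ 1 := by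
  simp only [transition, ← Finset.sum_div]
  exact div_self_le_one _

variable {ψ : ℝ × ℝ → ℝ} {φ : ℝ × ℝ × ℝ × ℝ → ℝ}

theorem drift_eq (y : V → ℝ) (v : V) :
    N.drift ψ φ y v =
      ∑ w ∈ N.nbrs v, N.transition v w * φ (y w, y v, (N.vmark v).1, (N.vmark w).1) +
        ψ (y v, (N.vmark v).1) := by
  simp only [drift, transition, Finset.mul_sum]
  congr 1
  exact Finset.sum_congr rfl fun w _ => by ring

theorem abs_interaction_le {M : ℝ} (hφb : ∀ z, |φ z| ≤ M) (y : V → ℝ) (v : V) :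
    |N.drift ψ φ y v - ψ (y v, (N.vmark v).1)| ≤ M := by
  have hM : 0 ≤ M := (abs_nonneg _).trans (hφb 0)
  rw [drift_eq, add_sub_cancel_right]
  calc _ ≤ ∑ w ∈ N.nbrs v, N.transition v w * M := by
        refine (Finset.abs_sum_le_sum_abs _ _).trans (Finset.sum_le_sum fun w _ => ?_)
        rw [abs_mul, abs_of_nonneg (N.transition_nonneg v w)]
        exact mul_le_mul_of_nonneg_left (hφb _) (N.transition_nonneg v w)
    _ = (∑ w ∈ N.nbrs v, N.transition v w) * M := by rw [Finset.sum_mul]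
    _ ≤ 1 * M := mul_le_mul_of_nonneg_right (N.sum_transition_le_one v) hM
    _ = M := one_mul M

theorem continuous_drift (hψ : Continuous ψ) (hφ : Continuous φ) {y : ℝ → V → ℝ}
    (hy : ∀ w, Continuous fun s => y s w) (v : V) :
    Continuous fun s => N.drift ψ φ (y s) v := by
  simp only [drift_eq]
  have := fun w => hy w
  refine Continuous.add (continuous_finsetSum _ fun w _ => ?_) (hψ.comp (by fun_prop))
  exact continuous_const.mul (hφ.comp (by fun_prop))

variable {V' : Type} (N' : Network V' StateMark Weight) (e : V → V')

/-- The distance of the data of `N` at `v` and of `N'` at `e v` that enter the drift. -/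
noncomputable def dataError (M K : ℝ) (v : V) : ℝ :=
  M * ∑ w ∈ N.nbrs v, |N'.transition (e v) (e w) - N.transition v w| +
    K * (|(N'.vmark (e v)).1 - (N.vmark v).1| +
      ∑ w ∈ N.nbrs v, |(N'.vmark (e w)).1 - (N.vmark w).1|)

variable {N' e}

/-- The hypotheses on `e` make it a bijection from the neighbours of `v` onto those of `e v`, so the
two averages can be compared term by term. A change of the transition probabilities costs the bound
`M`. A change of the arguments costs the Lipschitz constant, averaged with total mass at most one,
so the factor of `D` does not see the degree. -/
theorem abs_drift_sub_le {Kψ Kφ : ℝ≥0} {M : ℝ} (hψ : LipschitzWith Kψ ψ)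
    (hφ : LipschitzWith Kφ φ) (hφb : ∀ z, |φ z| ≤ M) {v : V}
    (hinj : Set.InjOn e {w | N.Adj v w})
    (hadj : ∀ w', N'.Adj (e v) w' ↔ ∃ w, N.Adj v w ∧ e w = w')
    {y : V → ℝ} {y' : V' → ℝ} {D : ℝ} (hv : |y' (e v) - y v| ≤ D)
    (hw : ∀ w, N.Adj v w → |y' (e w) - y w| ≤ D) :
    |N'.drift ψ φ y' (e v) - N.drift ψ φ y v| ≤
      N.dataError N' e M (Kφ + Kψ) v + (Kφ + Kψ) * D := by
  classical
  have hM : 0 ≤ M := (abs_nonneg _).trans (hφb 0)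
  have hD : 0 ≤ D := (abs_nonneg _).trans hv
  have hn : N'.nbrs (e v) = (N.nbrs v).image e := by
    ext w'
    simp [hadj]
  have hs : ∑ w' ∈ N'.nbrs (e v), N'.transition (e v) w' *
      φ (y' w', y' (e v), (N'.vmark (e v)).1, (N'.vmark w').1) =
      ∑ w ∈ N.nbrs v, N'.transition (e v) (e w) *
        φ (y' (e w), y' (e v), (N'.vmark (e v)).1, (N'.vmark (e w)).1) := by
    rw [hn, Finset.sum_image]
    intro a ha b hb hab
    exact hinj (by simpa using ha) (by simpa using hb) hab
  rw [drift_eq, drift_eq, hs]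
  set W : ℝ := ∑ w ∈ N.nbrs v, |(N'.vmark (e w)).1 - (N.vmark w).1| with hW
  set R : ℝ := |(N'.vmark (e v)).1 - (N.vmark v).1| with hR
  have hW0 : 0 ≤ W := Finset.sum_nonneg fun _ _ => abs_nonneg _
  have hR0 : 0 ≤ R := abs_nonneg _
  have hψ' : |ψ (y' (e v), (N'.vmark (e v)).1) - ψ (y v, (N.vmark v).1)| ≤ Kψ * (D + R) := by
    rw [← Real.dist_eq]
    refine (hψ.dist_le_mul _ _).trans (mul_le_mul_of_nonneg_left ?_ Kψ.2)
    rw [Prod.dist_eq, Real.dist_eq, Real.dist_eq]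
    exact max_le (by linarith) (by linarith)
  have hφ' : ∀ w ∈ N.nbrs v,
      |N'.transition (e v) (e w) *
          φ (y' (e w), y' (e v), (N'.vmark (e v)).1, (N'.vmark (e w)).1) -
        N.transition v w * φ (y w, y v, (N.vmark v).1, (N.vmark w).1)| ≤
      |N'.transition (e v) (e w) - N.transition v w| * M +
        N.transition v w * (Kφ * (D + R + W)) := by
    intro w hwn
    have e1 : ∀ a b c d : ℝ, a * c - b * d = (a - b) * c + b * (c - d) := fun a b c d => by ring
    rw [e1]
    refine (abs_add_le _ _).trans (add_le_add ?_ ?_)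
    · rw [abs_mul]
      exact mul_le_mul_of_nonneg_left (hφb _) (abs_nonneg _)
    · rw [abs_mul, abs_of_nonneg (N.transition_nonneg v w), ← Real.dist_eq]
      refine mul_le_mul_of_nonneg_left ((hφ.dist_le_mul _ _).trans ?_) (N.transition_nonneg v w)
      refine mul_le_mul_of_nonneg_left ?_ Kφ.2
      simp only [Prod.dist_eq, Real.dist_eq]
      have h1 := hw w (N.mem_nbrs.1 hwn)
      have h2 : |(N'.vmark (e w)).1 - (N.vmark w).1| ≤ W :=
        Finset.single_le_sum (f := fun w => |(N'.vmark (e w)).1 - (N.vmark w).1|)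
          (fun _ _ => abs_nonneg _) hwn
      exact max_le (by linarith) (max_le (by linarith) (max_le (by linarith) (by linarith)))
  have hsum := (Finset.abs_sum_le_sum_abs _ _).trans (Finset.sum_le_sum hφ')
  rw [Finset.sum_add_distrib, ← Finset.sum_mul, ← Finset.sum_mul, Finset.sum_sub_distrib] at hsum
  have hone := mul_le_mul_of_nonneg_right (N.sum_transition_le_one v)
    (mul_nonneg Kφ.2 (add_nonneg (add_nonneg hD hR0) hW0))
  have hKW : 0 ≤ (Kψ : ℝ) * W := mul_nonneg Kψ.2 hW0
  have e2 : ∀ a b c d : ℝ, a + b - (c + d) = (a - c) + (b - d) := fun a b c d => by ring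
  rw [e2, dataError]
  refine (abs_add_le _ _).trans ((add_le_add (hsum.trans (add_le_add le_rfl hone)) hψ').trans ?_)
  rw [← hW, ← hR]
  simp only [NNReal.val_eq_coe] at *
  linarith

/-- The crude counterpart of `abs_drift_sub_le`: each interaction term is bounded by `M`, so only
the state at the vertex itself is compared. This is the source of a priori bounds common to all
vertices. -/
theorem abs_drift_sub_le_of_bounded {Kψ : ℝ≥0} {M : ℝ} (hψ : LipschitzWith Kψ ψ)
    (hφb : ∀ z, |φ z| ≤ M) {v : V} (y : V → ℝ) (y' : V' → ℝ) :
    |N'.drift ψ φ y' (e v) - N.drift ψ φ y v| ≤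
      2 * M + Kψ * |(N'.vmark (e v)).1 - (N.vmark v).1| + Kψ * |y' (e v) - y v| := by
  have h1 := N'.abs_interaction_le (ψ := ψ) hφb y' (e v)
  have h2 := N.abs_interaction_le (ψ := ψ) hφb y v
  have h3 : |ψ (y' (e v), (N'.vmark (e v)).1) - ψ (y v, (N.vmark v).1)| ≤
      Kψ * (|(N'.vmark (e v)).1 - (N.vmark v).1| + |y' (e v) - y v|) := by
    rw [← Real.dist_eq]
    refine (hψ.dist_le_mul _ _).trans (mul_le_mul_of_nonneg_left ?_ Kψ.2)
    rw [Prod.dist_eq, Real.dist_eq, Real.dist_eq]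
    exact max_le (le_add_of_nonneg_left (abs_nonneg _)) (le_add_of_nonneg_right (abs_nonneg _))
  rw [abs_le] at *
  constructor <;> linarith [h1.1, h1.2, h2.1, h2.2, h3.1, h3.2]

end Drift

end Network

/-! ### Stability of solutions under local convergence -/

namespace Network

section Solutions

variable {V : Type} {T : ℝ}

/-- `θ` solves the integral equations of the network driven by the paths `b`. -/
def Solves (hT : 0 ≤ T) (ψ : ℝ × ℝ → ℝ) (φ : ℝ × ℝ × ℝ × ℝ → ℝ) (N : Network V StateMark Weight)
    (b θ : V → PathSpace T) : Prop :=
  ∀ (v : V) (t : Set.Icc (0 : ℝ) T),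
    θ v t = (N.vmark v).2 +
      (∫ s in (0 : ℝ)..t, N.drift ψ φ (fun w => Set.IccExtend hT (θ w) s) v) + b v t

/-- The networks `N' n` converge to `N` along the maps `e n`, at the vertices of a set `S` that is
closed under adjacency. -/
structure ConvergesAlong (N : Network V StateMark Weight) {V' : ℕ → Type}
    (N' : ∀ n, Network (V' n) StateMark Weight) (e : ∀ n, V → V' n) (S : Set V) : Prop where
  closed : ∀ v ∈ S, ∀ w, N.Adj v w → w ∈ S
  adj : ∀ v ∈ S, ∀ᶠ n in atTop, Set.InjOn (e n) {w | N.Adj v w} ∧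
    ∀ w', (N' n).Adj (e n v) w' ↔ ∃ w, N.Adj v w ∧ e n w = w'
  vmark : ∀ v ∈ S, Tendsto (fun n => (N' n).vmark (e n v)) atTop (𝓝 (N.vmark v))
  weight : ∀ v ∈ S, ∀ w, N.Adj v w →
    Tendsto (fun n => (N' n).weight (e n v) (e n w)) atTop (𝓝 (N.weight v w))

variable {N : Network V StateMark Weight} {V' : ℕ → Type}
  {N' : ∀ n, Network (V' n) StateMark Weight} {e : ∀ n, V → V' n} {S : Set V}

/-- Through this trivial case, stability yields uniqueness, causality and continuity in the drivers.
-/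
theorem ConvergesAlong.refl (N : Network V StateMark Weight) :
    N.ConvergesAlong (fun _ => N) (fun _ => id) Set.univ where
  closed _ _ _ _ := trivial
  adj _ _ := Eventually.of_forall fun _ => ⟨Function.injective_id.injOn, by simp⟩
  vmark _ _ := tendsto_const_nhds
  weight _ _ _ _ := tendsto_const_nhds

theorem ConvergesAlong.tendsto_transition (h : N.ConvergesAlong N' e S) {v w : V} (hv : v ∈ S)
    (hw : N.Adj v w) :
    Tendsto (fun n => (N' n).transition (e n v) (e n w)) atTop (𝓝 (N.transition v w)) := by
  refine (h.weight v hv w hw).div ?_ (N.totalWeight_pos hw).ne'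
  have h1 : Tendsto (fun n => ∑ u ∈ N.nbrs v, (N' n).weight (e n v) (e n u)) atTop
      (𝓝 (N.totalWeight v)) :=
    tendsto_finsetSum _ fun u hu => h.weight v hv u (N.mem_nbrs.1 hu)
  refine h1.congr' ?_
  filter_upwards [h.adj v hv] with n hn
  classical
  have hi : (N' n).nbrs (e n v) = (N.nbrs v).image (e n) := by
    ext w'
    simp [hn.2]
  rw [totalWeight, hi, Finset.sum_image]
  intro a ha b hb hab
  exact hn.1 (by simpa using ha) (by simpa using hb) hab

theorem ConvergesAlong.tendsto_dataError (h : N.ConvergesAlong N' e S) (M K : ℝ) {v : V}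
    (hv : v ∈ S) :
    Tendsto (fun n => N.dataError (N' n) (e n) M K v) atTop (𝓝 0) := by
  have hm : ∀ u ∈ S, Tendsto (fun n => |((N' n).vmark (e n u)).1 - (N.vmark u).1|) atTop (𝓝 0) := by
    intro u hu
    have := (((continuous_fst.tendsto _).comp (h.vmark u hu)).sub_const (N.vmark u).1).abs
    simpa using this
  have h1 : Tendsto (fun n => ∑ w ∈ N.nbrs v, |(N' n).transition (e n v) (e n w) -
      N.transition v w|) atTop (𝓝 (∑ w ∈ N.nbrs v, 0)) :=
    tendsto_finsetSum _ fun w hw => by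
      simpa using ((h.tendsto_transition hv (N.mem_nbrs.1 hw)).sub_const (N.transition v w)).abs
  have h2 : Tendsto (fun n => ∑ w ∈ N.nbrs v, |((N' n).vmark (e n w)).1 - (N.vmark w).1|) atTop
      (𝓝 (∑ w ∈ N.nbrs v, 0)) :=
    tendsto_finsetSum _ fun w hw => hm w (h.closed v hv w (N.mem_nbrs.1 hw))
  have := (h1.const_mul M).add (((hm v hv).add h2).const_mul K)
  simpa [dataError] using this

variable {hT : 0 ≤ T} {ψ : ℝ × ℝ → ℝ} {φ : ℝ × ℝ × ℝ × ℝ → ℝ} {Kψ Kφ : ℝ≥0} {M : ℝ}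
  {b θ : V → PathSpace T} {b' θ' : ∀ n, V' n → PathSpace T}

theorem continuous_drift_path (hψ : Continuous ψ) (hφ : Continuous φ)
    (N : Network V StateMark Weight) (θ : V → PathSpace T) (v : V) :
    Continuous fun s => N.drift ψ φ (fun w => Set.IccExtend hT (θ w) s) v :=
  N.continuous_drift hψ hφ (fun w => (θ w).continuous.Icc_extend') v

theorem abs_IccExtend_le {x y : PathSpace T} {τ : ℝ} {F : ℝ → ℝ}
    (h : ∀ s : Set.Icc (0 : ℝ) T, (s : ℝ) ≤ τ → |x s - y s| ≤ F s) {s : ℝ}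
    (hs : s ∈ Set.Icc 0 T) (hsτ : s ≤ τ) :
    |Set.IccExtend hT x s - Set.IccExtend hT y s| ≤ F s := by
  rw [Set.IccExtend_of_mem hT _ hs, Set.IccExtend_of_mem hT _ hs]
  exact h ⟨s, hs⟩ hsτ

/-- Bound on the difference of two solutions at a vertex from a bound on the difference of their
drifts. -/
theorem Solves.abs_sub_le {W : Type} {N₁ : Network W StateMark Weight} {b₁ θ₁ : W → PathSpace T}
    (hψ : Continuous ψ) (hφ : Continuous φ)
    (h₁ : Solves hT ψ φ N₁ b₁ θ₁) (h : Solves hT ψ φ N b θ) {v₁ : W} {v : V} {ε A K k : ℝ}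
    (hK : 0 ≤ K) (hk : 0 ≤ k) (hA : 0 ≤ A) {t : Set.Icc (0 : ℝ) T}
    (hi : |(N₁.vmark v₁).2 - (N.vmark v).2| ≤ ε) (hb : |b₁ v₁ t - b v t| ≤ ε)
    (hd : ∀ s ∈ Set.Icc (0 : ℝ) t,
      |N₁.drift ψ φ (fun w => Set.IccExtend hT (θ₁ w) s) v₁ -
        N.drift ψ φ (fun w => Set.IccExtend hT (θ w) s) v| ≤
        A + K * (k * Real.exp ((2 * K + 1) * s))) :
    |θ₁ v₁ t - θ v t| ≤ (2 * ε + A * T + k / 2) * Real.exp ((2 * K + 1) * t) := by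
  have hI := abs_integral_sub_le_of_exp_bound (N₁.continuous_drift_path (hT := hT) hψ hφ θ₁ v₁)
    (N.continuous_drift_path (hT := hT) hψ hφ θ v) hK hk t.2.1 hd
  have hε : 0 ≤ ε := (abs_nonneg _).trans hi
  have hexp : 1 ≤ Real.exp ((2 * K + 1) * t) :=
    Real.one_le_exp (mul_nonneg (by linarith) t.2.1)
  have hAt : A * (t : ℝ) ≤ A * T := mul_le_mul_of_nonneg_left t.2.2 hA
  have hpos : 0 ≤ 2 * ε + A * T := add_nonneg (by linarith) (mul_nonneg hA hT)
  have h3 := mul_le_mul_of_nonneg_left hexp hpos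
  rw [h₁ v₁ t, h v t]
  rw [abs_le] at *
  constructor <;> linarith [hI.1, hI.2, hi.1, hi.2, hb.1, hb.2]

/-- **Stability.**  If the networks `N' n` converge locally to `N` and the driving paths converge
up to time `τ`, then so do the solutions. -/
theorem ConvergesAlong.tendsto_solution (hc : N.ConvergesAlong N' e S)
    (hψ : LipschitzWith Kψ ψ) (hφ : LipschitzWith Kφ φ) (hφb : ∀ z, |φ z| ≤ M)
    (hθ : Solves hT ψ φ N b θ) (hθ' : ∀ n, Solves hT ψ φ (N' n) (b' n) (θ' n)) {τ : ℝ}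
    (hb : ∀ v ∈ S, ∀ ε > 0, ∀ᶠ n in atTop, ∀ s : Set.Icc (0 : ℝ) T, (s : ℝ) ≤ τ →
      |b' n (e n v) s - b v s| ≤ ε) :
    ∀ v ∈ S, ∀ ε > 0, ∀ᶠ n in atTop, ∀ s : Set.Icc (0 : ℝ) T, (s : ℝ) ≤ τ →
      |θ' n (e n v) s - θ v s| ≤ ε := by
  have hM : 0 ≤ M := (abs_nonneg _).trans (hφb 0)
  set K : ℝ := (Kφ : ℝ) + Kψ with hKdef
  have hK : 0 ≤ K := by positivity
  have hinit : ∀ v ∈ S, ∀ ε > 0, ∀ᶠ n in atTop,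
      |((N' n).vmark (e n v)).2 - (N.vmark v).2| ≤ ε ∧
        |((N' n).vmark (e n v)).1 - (N.vmark v).1| ≤ ε := by
    intro v hv ε hε
    filter_upwards [Metric.tendsto_atTop'.1 (hc.vmark v hv) ε hε |>.elim
      fun n₀ h => eventually_gt_atTop n₀ |>.mono fun n hn => h n hn] with n hn
    rw [Prod.dist_eq, max_lt_iff] at hn
    exact ⟨hn.2.le, hn.1.le⟩
  -- This is `2 * ε + A * T` from `Solves.abs_sub_le`, with all data errors at most `1` and drift
  -- error `A = 2 * M + Kψ`.
  set A₀ : ℝ := 2 * 1 + (2 * M + Kψ * 1) * T with hA₀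
  have hA₀0 : 0 ≤ A₀ := by positivity
  have hEpos : ∀ s : ℝ, 0 ≤ Real.exp ((2 * K + 1) * s) := fun s => (Real.exp_pos _).le
  -- No neighbour enters, so `2 * A₀` serves every vertex; only the index from which the bound holds
  -- depends on `v`. The improvement starts from the uniform distance of the two paths, which is
  -- finite but may depend on `n`, and forgets it.
  have apriori : ∀ v ∈ S, ∀ᶠ n in atTop, ∀ s : Set.Icc (0 : ℝ) T, (s : ℝ) ≤ τ →
      |θ' n (e n v) s - θ v s| ≤ 2 * A₀ * Real.exp ((2 * K + 1) * s) := by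
    intro v hv
    filter_upwards [hinit v hv 1 one_pos, hb v hv 1 one_pos] with n hn hbn s hs
    refine le_of_half_improving (ι := {s : Set.Icc (0 : ℝ) T // (s : ℝ) ≤ τ})
      (f := fun s => |θ' n (e n v) s.1 - θ v s.1|)
      (E := fun s => Real.exp ((2 * K + 1) * s.1)) hA₀0 (dist_nonneg (x := θ' n (e n v)) (y := θ v))
      (fun _ => hEpos _) ?_ ?_ ⟨s, hs⟩
    · intro s
      refine (show |θ' n (e n v) s.1 - θ v s.1| ≤ dist (θ' n (e n v)) (θ v) by
        rw [← Real.dist_eq]; exact ContinuousMap.dist_apply_le_dist s.1).trans ?_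
      exact le_mul_of_one_le_right dist_nonneg
        (Real.one_le_exp (mul_nonneg (by linarith) s.1.2.1))
    · intro k hk hbd s
      refine (hθ' n).abs_sub_le hψ.continuous hφ.continuous hθ hK hk (by positivity) hn.1
        (hbn s.1 s.2) ?_
      intro r hr
      refine (N.abs_drift_sub_le_of_bounded (N' := N' n) (e := e n) hψ hφb _ _).trans ?_
      refine add_le_add (add_le_add le_rfl (mul_le_mul_of_nonneg_left hn.2 Kψ.2)) ?_
      refine mul_le_mul (by rw [hKdef]; exact le_add_of_nonneg_left Kφ.2) ?_ (abs_nonneg _) hK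
      exact abs_IccExtend_le (F := fun s => k * Real.exp ((2 * K + 1) * s))
        (fun s hs => hbd ⟨s, hs⟩) ⟨hr.1, hr.2.trans s.1.2.2⟩ (hr.2.trans s.2)
  have step : ∀ c : ℝ, 0 < c → (∀ v ∈ S, ∀ᶠ n in atTop, ∀ s : Set.Icc (0 : ℝ) T, (s : ℝ) ≤ τ →
      |θ' n (e n v) s - θ v s| ≤ c * Real.exp ((2 * K + 1) * s)) →
      ∀ v ∈ S, ∀ᶠ n in atTop, ∀ s : Set.Icc (0 : ℝ) T, (s : ℝ) ≤ τ →
        |θ' n (e n v) s - θ v s| ≤ (3 / 4 * c) * Real.exp ((2 * K + 1) * s) := by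
    intro c hc0 hall v hv
    -- With all errors at most this `δ`, the total is `δ * (2 + T) + c / 2 = 3 / 4 * c`.
    have hδ : 0 < c / (4 * (2 + T)) := by positivity
    have hnb : ∀ᶠ n in atTop, ∀ w ∈ N.nbrs v, ∀ s : Set.Icc (0 : ℝ) T, (s : ℝ) ≤ τ →
        |θ' n (e n w) s - θ w s| ≤ c * Real.exp ((2 * K + 1) * s) :=
      (eventually_all_finset _).2 fun w hw =>
        hall w (hc.closed v hv w (N.mem_nbrs.1 hw))
    filter_upwards [hinit v hv _ hδ, hb v hv _ hδ, hall v hv, hnb, hc.adj v hv,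
      (hc.tendsto_dataError M K hv).eventually_le_const hδ] with n h1 h2 h3 h4 h5 h6 s hs
    have := (hθ' n).abs_sub_le hψ.continuous hφ.continuous hθ hK hc0.le hδ.le h1.1 (h2 s hs)
      (fun r hr => (N.abs_drift_sub_le hψ hφ hφb h5.1 h5.2
        (D := c * Real.exp ((2 * K + 1) * r))
        (abs_IccExtend_le (F := fun s => c * Real.exp ((2 * K + 1) * s)) h3
          ⟨hr.1, hr.2.trans s.2.2⟩ (hr.2.trans hs))
        (fun w hw => abs_IccExtend_le (F := fun s => c * Real.exp ((2 * K + 1) * s))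
          (h4 w (N.mem_nbrs.2 hw)) ⟨hr.1, hr.2.trans s.2.2⟩ (hr.2.trans hs))).trans
        (add_le_add h6 le_rfl))
    refine this.trans (mul_le_mul_of_nonneg_right (le_of_eq ?_) (hEpos _))
    field_simp
    ring
  have iter : ∀ m : ℕ, ∀ v ∈ S, ∀ᶠ n in atTop, ∀ s : Set.Icc (0 : ℝ) T, (s : ℝ) ≤ τ →
      |θ' n (e n v) s - θ v s| ≤ ((3 / 4) ^ m * (2 * A₀)) * Real.exp ((2 * K + 1) * s) := by
    intro m
    induction m with
    | zero => simpa using apriori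
    | succ m ih =>
      have := step _ (by positivity) ih
      simpa only [pow_succ', mul_assoc] using this
  intro v hv ε hε
  have hlim : Tendsto (fun m : ℕ => ((3 / 4 : ℝ) ^ m * (2 * A₀)) * Real.exp ((2 * K + 1) * T))
      atTop (𝓝 (0 * (2 * A₀) * Real.exp ((2 * K + 1) * T))) :=
    ((tendsto_pow_atTop_nhds_zero_of_lt_one (by norm_num) (by norm_num)).mul_const _).mul_const _
  obtain ⟨m, hm⟩ := (hlim.eventually_lt_const (u := ε) (by simpa using hε)).exists
  filter_upwards [iter m v hv] with n hn s hs
  refine (hn s hs).trans (le_trans ?_ hm.le)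
  refine mul_le_mul_of_nonneg_left ?_ (by positivity)
  exact Real.exp_le_exp.2 (mul_le_mul_of_nonneg_left s.2.2 (by linarith))

end Solutions

end Network

/-! ### Picard iteration -/

section Picard

variable {V : Type} {T : ℝ}

/-- Picard iteration for a map that halves weighted distances.  The weights `c v` need not be
bounded in `v`. -/
theorem exists_fixedPoint_of_halving {Φ : (V → PathSpace T) → V → PathSpace T} {l : ℝ}
    (hl : 0 ≤ l) {c : V → ℝ} (hc : ∀ v, 0 ≤ c v)
    (hΦ : ∀ k, 0 ≤ k → ∀ x y : V → PathSpace T,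
      (∀ v s, |x v s - y v s| ≤ k * c v * Real.exp (l * s)) →
      ∀ v s, |Φ x v s - Φ y v s| ≤ k / 2 * c v * Real.exp (l * s))
    {x₀ : V → PathSpace T} (h₀ : ∀ v s, |Φ x₀ v s - x₀ v s| ≤ c v) :
    ∃ θ, Φ θ = θ := by
  set x : ℕ → V → PathSpace T := fun n => Φ^[n] x₀ with hx
  have hsucc : ∀ n, x (n + 1) = Φ (x n) := fun n => Function.iterate_succ_apply' Φ n x₀
  have hstep : ∀ n v s, |x n v s - x (n + 1) v s| ≤ (1 / 2) ^ n * c v * Real.exp (l * s) := by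
    intro n
    induction n with
    | zero =>
      intro v s
      rw [hsucc, pow_zero, one_mul, abs_sub_comm]
      exact (h₀ v s).trans (le_mul_of_one_le_right (hc v) (Real.one_le_exp (mul_nonneg hl s.2.1)))
    | succ n ih =>
      intro v s
      have := hΦ _ (by positivity) _ _ ih v s
      rw [hsucc (n + 1), hsucc n]
      rw [hsucc n] at this
      refine this.trans (le_of_eq ?_)
      rw [pow_succ]
      ring
  have hdist : ∀ v n, dist (x n v) (x (n + 1) v) ≤ c v * Real.exp (l * T) * (1 / 2) ^ n := by
    intro v n
    rw [ContinuousMap.dist_le (mul_nonneg (mul_nonneg (hc v) (Real.exp_pos _).le) (by positivity))]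
    intro s
    rw [Real.dist_eq]
    have h1 : Real.exp (l * s) ≤ Real.exp (l * T) :=
      Real.exp_le_exp.2 (mul_le_mul_of_nonneg_left s.2.2 hl)
    have h2 : (0 : ℝ) ≤ (1 / 2) ^ n * c v := mul_nonneg (by positivity) (hc v)
    calc _ ≤ _ := hstep n v s
      _ ≤ (1 / 2) ^ n * c v * Real.exp (l * T) := mul_le_mul_of_nonneg_left h1 h2
      _ = _ := by ring
  have hlim : ∀ v, ∃ y, Tendsto (fun n => x n v) atTop (𝓝 y) := fun v =>
    cauchySeq_tendsto_of_complete (cauchySeq_of_le_geometric (1 / 2) _ (by norm_num) (hdist v))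
  choose θ hθ using hlim
  have heval : ∀ v s, Tendsto (fun n => x n v s) atTop (𝓝 (θ v s)) := fun v s =>
    ((continuous_eval_const s).tendsto _).comp (hθ v)
  have hrest : ∀ n v s, |x n v s - θ v s| ≤ 2 * (1 / 2) ^ n * c v * Real.exp (l * s) := by
    intro n v s
    have := dist_le_of_le_geometric_of_tendsto (1 / 2 : ℝ) (c v * Real.exp (l * s))
      (by norm_num) (f := fun n => x n v s) (fun n => by
        rw [Real.dist_eq]
        exact (hstep n v s).trans (le_of_eq (by ring))) (heval v s) n
    rw [Real.dist_eq] at this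
    refine this.trans (le_of_eq ?_)
    norm_num
    ring
  refine ⟨θ, funext fun v => ContinuousMap.ext fun s => ?_⟩
  have h1 : Tendsto (fun n => x (n + 1) v s) atTop (𝓝 (θ v s)) :=
    (tendsto_add_atTop_iff_nat 1).2 (heval v s)
  -- The halving hypothesis, applied to `x n` and the limit `θ`, serves as the continuity of `Φ`
  -- along the iterates.
  have h2 : Tendsto (fun n => x (n + 1) v s) atTop (𝓝 (Φ θ v s)) := by
    rw [tendsto_iff_dist_tendsto_zero]
    have h3 : Tendsto (fun n : ℕ => (2 * (1 / 2 : ℝ) ^ n) / 2 * c v * Real.exp (l * s)) atTop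
        (𝓝 ((2 * 0) / 2 * c v * Real.exp (l * s))) :=
      ((((tendsto_pow_atTop_nhds_zero_of_lt_one (by norm_num)
        (by norm_num)).const_mul 2).div_const 2).mul_const _).mul_const _
    rw [mul_zero, zero_div, zero_mul, zero_mul] at h3
    refine squeeze_zero (fun _ => dist_nonneg) (fun n => ?_) h3
    rw [Real.dist_eq, hsucc]
    exact hΦ _ (by positivity) _ _ (hrest n) v s
  exact tendsto_nhds_unique h2 h1

/-- Existence for integral equations driven by continuous paths. -/
theorem exists_integral_solution (hT : 0 ≤ T) {F : (V → ℝ) → V → ℝ} {K : ℝ} (hK : 0 ≤ K)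
    (hF : ∀ (θ : V → PathSpace T) v, Continuous fun s => F (fun w => Set.IccExtend hT (θ w) s) v)
    (a : V → ℝ) (b : V → PathSpace T) {c : V → ℝ} (hc : ∀ v, 0 ≤ c v)
    (hLip : ∀ k, 0 ≤ k → ∀ y y' : V → ℝ, (∀ w, |y w - y' w| ≤ k * c w) →
      ∀ v, |F y v - F y' v| ≤ K * (k * c v))
    {x₀ : V → PathSpace T}
    (h₀ : ∀ v (t : Set.Icc (0 : ℝ) T),
      |a v + (∫ s in (0 : ℝ)..t, F (fun w => Set.IccExtend hT (x₀ w) s) v) + b v t - x₀ v t| ≤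
        c v) :
    ∃ θ : V → PathSpace T, ∀ v (t : Set.Icc (0 : ℝ) T),
      θ v t = a v + (∫ s in (0 : ℝ)..t, F (fun w => Set.IccExtend hT (θ w) s) v) + b v t := by
  let Φ : (V → PathSpace T) → V → PathSpace T := fun θ v =>
    ⟨fun t => a v + (∫ s in (0 : ℝ)..t, F (fun w => Set.IccExtend hT (θ w) s) v) + b v t, by
      have h1 : Continuous fun t : ℝ => ∫ s in (0 : ℝ)..t, F (fun w => Set.IccExtend hT (θ w) s) v :=
        intervalIntegral.continuous_primitive (fun _ _ => (hF θ v).intervalIntegrable _ _) 0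
      have h2 := h1.comp (continuous_subtype_val (p := fun t => t ∈ Set.Icc (0 : ℝ) T))
      exact (continuous_const.add h2).add (b v).continuous⟩
  obtain ⟨θ, hθ⟩ := exists_fixedPoint_of_halving (Φ := Φ) (l := 2 * K + 1) (by linarith) hc
    (fun k hk x y hxy v t => by
      have := abs_integral_sub_le_of_exp_bound (hF x v) (hF y v) (A := 0) hK
        (mul_nonneg hk (hc v)) t.2.1 (fun s hs => by
          have hs' : s ∈ Set.Icc 0 T := ⟨hs.1, hs.2.trans t.2.2⟩
          have := hLip (k * Real.exp ((2 * K + 1) * s)) (by positivity)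
            (fun w => Set.IccExtend hT (x w) s) (fun w => Set.IccExtend hT (y w) s) (fun w => by
              rw [Set.IccExtend_of_mem hT _ hs', Set.IccExtend_of_mem hT _ hs']
              exact (hxy w ⟨s, hs'⟩).trans (le_of_eq (by ring))) v
          refine this.trans (le_of_eq ?_)
          ring)
      have e : Φ x v t - Φ y v t =
          (∫ s in (0 : ℝ)..t, F (fun w => Set.IccExtend hT (x w) s) v) -
            ∫ s in (0 : ℝ)..t, F (fun w => Set.IccExtend hT (y w) s) v := by
        simp only [Φ, ContinuousMap.coe_mk]
        ring
      rw [e]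
      refine this.trans (le_of_eq ?_)
      ring) h₀
  exact ⟨θ, fun v t => (DFunLike.congr_fun (congrFun hθ v) t).symm⟩

end Picard

/-! ### Pathwise existence and uniqueness, and the flow -/

namespace Network

variable {V : Type} {T : ℝ} {ψ : ℝ × ℝ → ℝ} {φ : ℝ × ℝ × ℝ × ℝ → ℝ} {Kψ Kφ : ℝ≥0} {M : ℝ}

/-- The marks and drivers may be unbounded over the vertices, while coupled vertices call for a
common Picard weight. Hence two stages. The system without interaction decouples, so weights
depending on the vertex are allowed there. Started from its solution `η`, the first Picard step of
the full system only adds the integrated interaction, which is at most `M * T` at every vertex. -/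
theorem exists_solves (hT : 0 ≤ T) (hψ : LipschitzWith Kψ ψ) (hφ : LipschitzWith Kφ φ)
    (hφb : ∀ z, |φ z| ≤ M) (N : Network V StateMark Weight) (b : V → PathSpace T) :
    ∃ θ, Solves hT ψ φ N b θ := by
  have hM : 0 ≤ M := (abs_nonneg _).trans (hφb 0)
  have hcont : ∀ (θ : V → PathSpace T) (v : V),
      Continuous fun s => ψ (Set.IccExtend hT (θ v) s, (N.vmark v).1) := fun θ v =>
    hψ.continuous.comp ((θ v).continuous.Icc_extend'.prodMk continuous_const)
  have hbd : ∀ v, ∃ c : ℝ, 0 ≤ c ∧ ∀ t : Set.Icc (0 : ℝ) T,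
      |(N.vmark v).2 + (∫ s in (0 : ℝ)..t, ψ (Set.IccExtend hT (b v) s, (N.vmark v).1)) + b v t -
        b v t| ≤ c := by
    intro v
    have h1 : Continuous fun t : ℝ => (N.vmark v).2 +
        ∫ s in (0 : ℝ)..t, ψ (Set.IccExtend hT (b v) s, (N.vmark v).1) :=
      continuous_const.add
        (intervalIntegral.continuous_primitive (fun _ _ => (hcont b v).intervalIntegrable _ _) 0)
    obtain ⟨c, hc⟩ := (isCompact_Icc (a := (0 : ℝ)) (b := T)).exists_bound_of_continuousOn
      h1.continuousOn
    refine ⟨c, (norm_nonneg _).trans (hc 0 ⟨le_rfl, hT⟩), fun t => ?_⟩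
    rw [add_sub_cancel_right]
    exact hc t t.2
  choose c hc0 hc using hbd
  obtain ⟨η, hη⟩ := exists_integral_solution hT (F := fun y v => ψ (y v, (N.vmark v).1)) Kψ.2
    hcont (fun v => (N.vmark v).2) b hc0
    (fun k hk y y' h v => by
      rw [← Real.dist_eq]
      refine (hψ.dist_le_mul _ _).trans (mul_le_mul_of_nonneg_left ?_ Kψ.2)
      rw [Prod.dist_eq, dist_self, Real.dist_eq]
      exact max_le (h v) ((abs_nonneg _).trans (h v))) (x₀ := b) hc
  have hMT : 0 ≤ M * T := mul_nonneg hM hT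
  obtain ⟨θ, hθ⟩ := exists_integral_solution hT (F := N.drift ψ φ) (K := Kφ + Kψ) (by positivity)
    (fun θ v => N.continuous_drift_path hψ.continuous hφ.continuous θ v)
    (fun v => (N.vmark v).2) b (c := fun _ => M * T) (fun _ => hMT)
    (fun k hk y y' h v => by
      have := N.abs_drift_sub_le (N' := N) (e := id) hψ hφ hφb (v := v)
        Function.injective_id.injOn (by simp) (h v) (fun w _ => h w)
      refine this.trans (le_of_eq ?_)
      simp [dataError]) (x₀ := η)
    (fun v t => by
      have e : (N.vmark v).2 + (∫ s in (0 : ℝ)..t,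
          N.drift ψ φ (fun w => Set.IccExtend hT (η w) s) v) + b v t - η v t =
          ∫ s in (0 : ℝ)..t, (N.drift ψ φ (fun w => Set.IccExtend hT (η w) s) v -
            ψ (Set.IccExtend hT (η v) s, (N.vmark v).1)) := by
        rw [intervalIntegral.integral_sub
          ((N.continuous_drift_path hψ.continuous hφ.continuous η v).intervalIntegrable _ _)
          ((hcont η v).intervalIntegrable _ _), hη v t]
        ring
      rw [e, ← Real.norm_eq_abs]
      refine (intervalIntegral.norm_integral_le_of_norm_le_const
        (fun s _ => N.abs_interaction_le hφb _ v)).trans ?_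
      rw [sub_zero, abs_of_nonneg t.2.1]
      exact mul_le_mul_of_nonneg_left t.2.2 hM)
  exact ⟨θ, hθ⟩

/-- Stability along the constant sequence, with drivers that agree up to `τ`. The cutoff `τ` is what
gives adaptedness later. -/
theorem Solves.eq_upto {hT : 0 ≤ T} (hψ : LipschitzWith Kψ ψ) (hφ : LipschitzWith Kφ φ)
    (hφb : ∀ z, |φ z| ≤ M) {N : Network V StateMark Weight} {b b' θ θ' : V → PathSpace T}
    (h : Solves hT ψ φ N b θ) (h' : Solves hT ψ φ N b' θ') {τ : ℝ}
    (hb : ∀ v (s : Set.Icc (0 : ℝ) T), (s : ℝ) ≤ τ → b' v s = b v s) (v : V)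
    (s : Set.Icc (0 : ℝ) T) (hs : (s : ℝ) ≤ τ) : θ' v s = θ v s := by
  refine eq_of_abs_sub_nonpos (le_of_forall_pos_le_add fun ε hε => ?_)
  have := (ConvergesAlong.refl N).tendsto_solution hψ hφ hφb h (fun _ => h') (τ := τ)
    (fun v _ ε hε => Eventually.of_forall fun _ s hs => by simp [hb v s hs, hε.le]) v trivial ε hε
  obtain ⟨_, hn⟩ := this.exists
  simpa using hn s hs

theorem Solves.unique {hT : 0 ≤ T} (hψ : LipschitzWith Kψ ψ) (hφ : LipschitzWith Kφ φ)
    (hφb : ∀ z, |φ z| ≤ M) {N : Network V StateMark Weight} {b θ θ' : V → PathSpace T}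
    (h : Solves hT ψ φ N b θ) (h' : Solves hT ψ φ N b θ') : θ' = θ :=
  funext fun v => ContinuousMap.ext fun s =>
    h.eq_upto hψ hφ hφb h' (τ := T) (fun _ _ _ => rfl) v s s.2.2

/-- The solution as a function of the driving paths. -/
noncomputable def flow (hT : 0 ≤ T) (ψ : ℝ × ℝ → ℝ) (φ : ℝ × ℝ × ℝ × ℝ → ℝ)
    (N : Network V StateMark Weight) (b : V → PathSpace T) : V → PathSpace T :=
  Classical.epsilon (Solves hT ψ φ N b)

theorem flow_solves {hT : 0 ≤ T} (hψ : LipschitzWith Kψ ψ) (hφ : LipschitzWith Kφ φ)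
    (hφb : ∀ z, |φ z| ≤ M) (N : Network V StateMark Weight) (b : V → PathSpace T) :
    Solves hT ψ φ N b (N.flow hT ψ φ b) :=
  Classical.epsilon_spec (N.exists_solves hT hψ hφ hφb b)

/-- Stability of the flow in the uniform distance of the paths. -/
theorem ConvergesAlong.tendsto_flow {hT : 0 ≤ T} (hψ : LipschitzWith Kψ ψ)
    (hφ : LipschitzWith Kφ φ) (hφb : ∀ z, |φ z| ≤ M) {N : Network V StateMark Weight}
    {V' : ℕ → Type} {N' : ∀ n, Network (V' n) StateMark Weight} {e : ∀ n, V → V' n} {S : Set V}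
    (hc : N.ConvergesAlong N' e S) {b : V → PathSpace T} {b' : ∀ n, V' n → PathSpace T}
    (hb : ∀ v ∈ S, Tendsto (fun n => b' n (e n v)) atTop (𝓝 (b v))) {v : V} (hv : v ∈ S) :
    Tendsto (fun n => (N' n).flow hT ψ φ (b' n) (e n v)) atTop (𝓝 (N.flow hT ψ φ b v)) := by
  have := hc.tendsto_solution hψ hφ hφb (N.flow_solves hψ hφ hφb b)
    (fun n => (N' n).flow_solves hψ hφ hφb (b' n)) (hT := hT) (τ := T) (fun v hv ε hε => by
      filter_upwards [(Metric.tendsto_nhds.1 (hb v hv)) ε hε] with n hn s _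
      rw [← Real.dist_eq]
      exact (ContinuousMap.dist_apply_le_dist s).trans hn.le) v hv
  rw [Metric.tendsto_nhds]
  intro ε hε
  filter_upwards [this (ε / 2) (half_pos hε)] with n hn
  refine lt_of_le_of_lt ((ContinuousMap.dist_le (half_pos hε).le).2 fun s => ?_) (half_lt_self hε)
  rw [Real.dist_eq]
  exact hn s s.2.2

/-- For countable `V` the product of path spaces is sequential, so stability along sequences
suffices. -/
theorem continuous_flow [Countable V] {hT : 0 ≤ T} (hψ : LipschitzWith Kψ ψ)
    (hφ : LipschitzWith Kφ φ) (hφb : ∀ z, |φ z| ≤ M) (N : Network V StateMark Weight) :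
    Continuous (N.flow hT ψ φ) := by
  refine SeqContinuous.continuous fun b' b hb => ?_
  rw [tendsto_pi_nhds] at *
  exact fun v => (ConvergesAlong.refl N).tendsto_flow hψ hφ hφb (fun v _ => hb v) trivial

end Network

/-! ### Measurability of paths and completion by null sets -/

noncomputable instance PathSpace.instMeasurableSpace (T : ℝ) : MeasurableSpace (PathSpace T) :=
  borel _

instance PathSpace.instBorelSpace (T : ℝ) : BorelSpace (PathSpace T) := ⟨rfl⟩

/-- A random path is measurable as soon as its values at fixed times are. -/
theorem PathSpace.measurable_of_eval {T : ℝ} {Ω : Type*} {m : MeasurableSpace Ω}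
    {f : Ω → PathSpace T} (h : ∀ t, Measurable fun ω => f ω t) : Measurable f := by
  have hball : ∀ (x : PathSpace T) (r : ℝ), 0 ≤ r →
      MeasurableSet (f ⁻¹' Metric.closedBall x r) := by
    intro x r hr
    obtain ⟨Q, hQc, hQd⟩ := TopologicalSpace.exists_countable_dense (Set.Icc (0 : ℝ) T)
    -- By continuity of paths the uniform distance is controlled at countably many times.
    have e : f ⁻¹' Metric.closedBall x r = ⋂ t ∈ Q, {ω | dist (f ω t) (x t) ≤ r} := by
      ext ω
      simp only [Set.mem_preimage, Metric.mem_closedBall, ContinuousMap.dist_le hr, Set.mem_iInter,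
        Set.mem_ofPred_eq]
      refine ⟨fun h t _ => h t, fun h t => ?_⟩
      have hcl : IsClosed {t | dist (f ω t) (x t) ≤ r} :=
        isClosed_le ((f ω).continuous.dist x.continuous) continuous_const
      exact hcl.closure_subset_iff.2 (fun t ht => h t ht) (hQd t)
    rw [e]
    exact MeasurableSet.biInter hQc fun t _ =>
      measurableSet_le ((h t).dist measurable_const) measurable_const
  have hb : TopologicalSpace.IsTopologicalBasis
      {s : Set (PathSpace T) | ∃ x r, s = Metric.ball x r} := by
    refine TopologicalSpace.isTopologicalBasis_of_isOpen_of_nhds ?_ ?_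
    · rintro _ ⟨x, r, rfl⟩
      exact Metric.isOpen_ball
    · intro a u ha hu
      obtain ⟨ε, hε, hsub⟩ := Metric.isOpen_iff.1 hu a ha
      exact ⟨_, ⟨a, ε, rfl⟩, Metric.mem_ball_self hε, hsub⟩
  rw [show PathSpace.instMeasurableSpace T = _ from hb.borel_eq_generateFrom]
  refine measurable_generateFrom ?_
  rintro _ ⟨x, r, rfl⟩
  have e : Metric.ball x r = ⋃ n : ℕ, ⋃ _ : 0 ≤ r - 1 / ((n : ℝ) + 1),
      Metric.closedBall x (r - 1 / ((n : ℝ) + 1)) := by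
    ext y
    simp only [Metric.mem_ball, Set.mem_iUnion, Metric.mem_closedBall, exists_prop]
    constructor
    · intro hy
      obtain ⟨n, hn⟩ := exists_nat_one_div_lt (sub_pos.2 hy)
      have := dist_nonneg (x := y) (y := x)
      exact ⟨n, by linarith, by linarith⟩
    · rintro ⟨n, _, hn⟩
      have : (0 : ℝ) < 1 / ((n : ℝ) + 1) := by positivity
      linarith
  rw [e, Set.preimage_iUnion]
  refine MeasurableSet.iUnion fun n => ?_
  rw [Set.preimage_iUnion]
  exact MeasurableSet.iUnion fun hn => hball x _ hn

/-- Each of the finitely many fibres is replaced by a set measurable for `m`. The new sets need not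
be disjoint, but almost surely membership in them agrees with membership in the fibres. -/
theorem MeasureTheory.SimpleFunc.exists_measurable_ae_eq {Ω : Type*} {m m₀ : MeasurableSpace Ω}
    {P : Measure[m₀] Ω} {m' : MeasurableSpace Ω}
    (h : ∀ A, MeasurableSet[m'] A → ∃ A', MeasurableSet[m] A' ∧ A =ᵐ[P] A')
    (s : SimpleFunc Ω ℝ) : ∃ g : Ω → ℝ, Measurable[m] g ∧ ∀ᵐ ω ∂P, s ω = g ω := by
  choose A hAm hA using fun y : ℝ => h _ (s.measurableSet_fiber y)
  refine ⟨fun ω => ∑ y ∈ s.range, (A y).indicator (fun _ => y) ω,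
    @Finset.measurable_fun_sum _ _ _ _ _ _ m _ _ fun y _ =>
      measurable_const.indicator (hAm y), ?_⟩
  have hall : ∀ᵐ ω ∂P, ∀ y ∈ s.range, (s ω = y ↔ ω ∈ A y) :=
    (ae_ball_iff s.range.countable_toSet).2 fun y _ => by
      filter_upwards [hA y] with ω hω
      exact iff_of_eq hω
  filter_upwards [hall] with ω hω
  classical
  rw [Finset.sum_congr rfl (g := fun y => if s ω = y then y else 0) fun y hy => by
    simp only [Set.indicator_apply, hω y hy]]
  simp

/-- A function that is measurable modulo null sets agrees almost everywhere with a measurable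
one. -/
theorem EventuallyMeasurable.exists_measurable_ae_eq {Ω : Type*} {m m₀ : MeasurableSpace Ω}
    {P : Measure[m₀] Ω} {f : Ω → ℝ} (hf : EventuallyMeasurable m (ae P) f) :
    ∃ g : Ω → ℝ, Measurable[m] g ∧ f =ᵐ[P] g := by
  have hs : @StronglyMeasurable Ω ℝ _ (eventuallyMeasurableSpace m (ae P)) f :=
    @Measurable.stronglyMeasurable _ _ f (eventuallyMeasurableSpace m (ae P)) _ _ _ _ _ hf
  choose g hgm hg using fun n => (hs.approx n).exists_measurable_ae_eq (m := m) (P := P)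
    fun A (hA : EventuallyMeasurableSet m (ae P) A) => hA
  -- The replaced approximations converge only almost everywhere; the limsup is measurable
  -- regardless.
  refine ⟨fun ω => limsup (fun n => g n ω) atTop, Measurable.limsup hgm, ?_⟩
  filter_upwards [ae_all_iff.2 hg] with ω hω
  have := hs.tendsto_approx ω
  simp only [hω] at this
  exact this.limsup_eq.symm

/-! ### Continuous versions of Brownian families and uniqueness of their law -/

section Brownian

variable {V : Type} {T : ℝ} {Ω : Type*} [MeasurableSpace Ω] {P : Measure Ω}

/-- The paths `b` on `[0, T]` are a version of the processes `B`. -/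
structure IsPathVersion (B : V → ℝ≥0 → Ω → ℝ) (P : Measure Ω) (b : Ω → V → PathSpace T) :
    Prop where
  measurable : Measurable b
  ae_eq : ∀ᵐ ω ∂P, ∀ v (t : Set.Icc (0 : ℝ) T), b ω v t = B v ⟨t, t.2.1⟩ ω

/-- Continuity holds only almost surely, so the paths are set to zero on a measurable null set that
contains all exceptions. -/
theorem IsBrownianFamily.exists_pathVersion [Countable V] {B : V → ℝ≥0 → Ω → ℝ}
    (hB : IsBrownianFamily B P) (T : ℝ) : ∃ b : Ω → V → PathSpace T, IsPathVersion B P b := by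
  classical
  have hc : ∀ᵐ ω ∂P, ∀ v, Continuous (B v · ω) := ae_all_iff.2 fun v => (hB.brownian v).cont
  obtain ⟨A, hsub, hAm, hA0⟩ := exists_measurable_superset_of_null (ae_iff.1 hc)
  have hcont : ∀ ω ∉ A, ∀ v, Continuous (B v · ω) := fun ω hω => by
    by_contra h
    exact hω (hsub h)
  refine ⟨fun ω v => if h : ω ∈ A then 0 else
    ⟨fun t => B v ⟨t, t.2.1⟩ ω, (hcont ω h v).comp (by fun_prop)⟩, ?_, ?_⟩
  · refine measurable_pi_lambda _ fun v => PathSpace.measurable_of_eval fun t => ?_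
    have e : (fun ω => (if h : ω ∈ A then (0 : PathSpace T) else
        ⟨fun t => B v ⟨t, t.2.1⟩ ω, (hcont ω h v).comp (by fun_prop)⟩ : PathSpace T) t) =
        fun ω => if ω ∈ A then 0 else B v ⟨t, t.2.1⟩ ω := by
      ext ω
      split_ifs <;> rfl
    rw [e]
    exact Measurable.ite hAm measurable_const (hB.measurable v _)
  · filter_upwards [compl_mem_ae_iff.2 hA0] with ω hω v t
    rw [dif_neg hω]
    rfl

theorem IsBrownianFamily.comp {I : Type} {B : V → ℝ≥0 → Ω → ℝ} (hB : IsBrownianFamily B P)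
    {g : I → V} (hg : Function.Injective g) : IsBrownianFamily (fun i => B (g i)) P where
  measurable i t := hB.measurable (g i) t
  brownian i := hB.brownian (g i)
  indep := hB.indep.precomp hg

theorem IsPathVersion.comp {I : Type} {B : V → ℝ≥0 → Ω → ℝ} {b : Ω → V → PathSpace T}
    (hb : IsPathVersion B P b) (g : I → V) :
    IsPathVersion (fun i => B (g i)) P (fun ω i => b ω (g i)) where
  measurable := measurable_pi_lambda _ fun i => (measurable_pi_apply (g i)).comp hb.measurable
  ae_eq := hb.ae_eq.mono fun _ h i t => h (g i) t

theorem ProbabilityTheory.IsBrownianReal.map_eq {Ω' : Type*} [MeasurableSpace Ω'] {P' : Measure Ω'}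
    {X : ℝ≥0 → Ω → ℝ} {X' : ℝ≥0 → Ω' → ℝ} (hX : IsBrownianReal X P) (hX' : IsBrownianReal X' P')
    (hm : ∀ t, Measurable (X t)) (hm' : ∀ t, Measurable (X' t)) :
    P.map (fun ω t => X t ω) = P'.map (fun ω t => X' t ω) := by
  have hmeas : Measurable fun ω t => X t ω := measurable_pi_lambda _ hm
  have hmeas' : Measurable fun ω t => X' t ω := measurable_pi_lambda _ hm'
  have h1 : IsProjectiveLimit (P.map fun ω t => X t ω) BrownianReal.projectiveFamily := fun I => by
    rw [Measure.map_map (Finset.measurable_restrict I) hmeas]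
    exact (hX.hasLaw I).map_eq
  have h2 : IsProjectiveLimit (P'.map fun ω t => X' t ω) BrownianReal.projectiveFamily :=
    fun I => by
      rw [Measure.map_map (Finset.measurable_restrict I) hmeas']
      exact (hX'.hasLaw I).map_eq
  exact h1.unique h2

/-- Independence turns the joint law into the product of the marginals, which is then restricted to
the times in `[0, T]`. -/
theorem IsPathVersion.map_eval [IsProbabilityMeasure P] {B : V → ℝ≥0 → Ω → ℝ}
    {b : Ω → V → PathSpace T} (hb : IsPathVersion B P b) (hB : IsBrownianFamily B P) :
    P.map (fun ω v t => b ω v t) =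
      (Measure.infinitePi fun v => P.map fun ω t => B v t ω).map
        fun y v (t : Set.Icc (0 : ℝ) T) => y v ⟨t, t.2.1⟩ := by
  have hBm : ∀ v, Measurable fun ω t => B v t ω := fun v =>
    measurable_pi_lambda _ (hB.measurable v)
  rw [← hB.indep.map_fun_eq_infinitePi_map hBm,
    Measure.map_map (by fun_prop) (measurable_pi_lambda _ hBm)]
  refine Measure.map_congr ?_
  filter_upwards [hb.ae_eq] with ω hω
  exact funext fun v => funext fun t => hω v t

/-- All families of i.i.d. Brownian motions have the same law. -/
theorem IsPathVersion.map_eq {Ω' : Type*} [MeasurableSpace Ω'] {P' : Measure Ω'}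
    [IsProbabilityMeasure P] [IsProbabilityMeasure P']
    {B : V → ℝ≥0 → Ω → ℝ} {B' : V → ℝ≥0 → Ω' → ℝ} {b : Ω → V → PathSpace T}
    {b' : Ω' → V → PathSpace T} (hB : IsBrownianFamily B P) (hB' : IsBrownianFamily B' P')
    (hb : IsPathVersion B P b) (hb' : IsPathVersion B' P' b') : P.map b = P'.map b' := by
  let E : (V → PathSpace T) → V → Set.Icc (0 : ℝ) T → ℝ := fun x v t => x v t
  let R : (V → ℝ≥0 → ℝ) → V → Set.Icc (0 : ℝ) T → ℝ := fun y v t => y v ⟨t, t.2.1⟩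
  have hE : Measurable E := measurable_pi_lambda _ fun v => measurable_pi_lambda _ fun t =>
    (continuous_eval_const (F := PathSpace T) t).measurable.comp (measurable_pi_apply v)
  -- The Borel sets of the path spaces are generated by evaluations, so a law there is determined by
  -- its image under `E`.
  have hgen : ∀ s : Set (V → PathSpace T), MeasurableSet s → ∃ s', MeasurableSet s' ∧ E ⁻¹' s' = s := by
    have hid : @Measurable _ _ (MeasurableSpace.comap E inferInstance) _
        (id : (V → PathSpace T) → V → PathSpace T) := by
      refine @measurable_pi_lambda _ _ _ (MeasurableSpace.comap E inferInstance) _ _ fun v => ?_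
      refine PathSpace.measurable_of_eval fun t => ?_
      have h1 : @Measurable _ _ (MeasurableSpace.comap E inferInstance) _ E := comap_measurable E
      have h2 : Measurable fun z : V → Set.Icc (0 : ℝ) T → ℝ => z v t := by fun_prop
      exact h2.comp h1
    intro s hs
    exact hid hs
  have hlaw : (fun v => P.map fun ω t => B v t ω) = fun v => P'.map fun ω t => B' v t ω :=
    funext fun v =>
      (hB.brownian v).map_eq (hB'.brownian v) (hB.measurable v) (hB'.measurable v)
  have key : (P.map b).map E = (P'.map b').map E := by
    rw [Measure.map_map hE hb.measurable, Measure.map_map hE hb'.measurable]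
    exact (hb.map_eval hB).trans ((congrArg (fun G => (Measure.infinitePi G).map R) hlaw).trans
      (hb'.map_eval hB').symm)
  ext s hs
  obtain ⟨s', hs', rfl⟩ := hgen s hs
  rw [← Measure.map_apply hE hs', ← Measure.map_apply hE hs', key]

end Brownian

/-! ### Strong solutions and the flow -/

section StrongSolutions

variable {V : Type} {T : ℝ} {Ω : Type u} [MeasurableSpace Ω] {P : Measure Ω}
  {ψ : ℝ × ℝ → ℝ} {φ : ℝ × ℝ × ℝ × ℝ → ℝ} {Kψ Kφ : ℝ≥0} {M : ℝ}

/-- The path `x`, kept constant after time `τ`. -/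
def PathSpace.freeze (τ : Set.Icc (0 : ℝ) T) (x : PathSpace T) : PathSpace T :=
  ⟨fun s => x ⟨min s τ, le_min s.2.1 τ.2.1, (min_le_left _ _).trans s.2.2⟩, by fun_prop⟩

/-- For adaptedness, the value at time `t` does not change when the drivers are frozen at `t`. The
frozen drivers are measurable for the past up to null sets (`b` agrees with `B` only almost surely),
and the flow is continuous. -/
theorem isStrongSolution_flow [Countable V] {hT : 0 ≤ T} (hψ : LipschitzWith Kψ ψ)
    (hφ : LipschitzWith Kφ φ) (hφb : ∀ z, |φ z| ≤ M) (N : Network V StateMark Weight)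
    {B : V → ℝ≥0 → Ω → ℝ} {b : Ω → V → PathSpace T} (hb : IsPathVersion B P b) :
    IsStrongSolution hT ψ φ N B P fun ω => N.flow hT ψ φ (b ω) where
  adapted v t := by
    have hfreeze : EventuallyMeasurable (pastSigma B t) (ae P)
        fun ω w => PathSpace.freeze t (b ω w) := by
      refine @measurable_pi_lambda _ _ _ (eventuallyMeasurableSpace (pastSigma B t) (ae P)) _ _
        fun w => PathSpace.measurable_of_eval fun s => ?_
      have hle : min (s : ℝ) t ≤ t := min_le_right _ _
      have hBm : Measurable[pastSigma B t] (B w ⟨min s t, le_min s.2.1 t.2.1⟩) := by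
        rw [measurable_iff_comap_le]
        exact le_iSup_of_le w (le_iSup_of_le (⟨min s t, le_min s.2.1 t.2.1⟩ : ℝ≥0)
          (le_iSup_of_le hle le_rfl))
      refine hBm.eventuallyMeasurable_of_eventuallyEq ?_
      filter_upwards [hb.ae_eq] with ω hω
      exact hω w _
    have hflow : Measurable fun x : V → PathSpace T => N.flow hT ψ φ x v t :=
      ((continuous_eval_const (F := PathSpace T) t).comp
        ((continuous_apply v).comp (N.continuous_flow hψ hφ hφb))).measurable
    obtain ⟨g, hg, hge⟩ := (hflow.comp_eventuallyMeasurable hfreeze).exists_measurable_ae_eq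
    refine ⟨g, hg, ?_⟩
    filter_upwards [hge] with ω hω
    rw [← hω]
    refine (N.flow_solves hψ hφ hφb _).eq_upto hψ hφ hφb (N.flow_solves hψ hφ hφb _)
      (τ := t) (fun w s hs => ?_) v t le_rfl
    simp only [PathSpace.freeze, ContinuousMap.coe_mk, min_eq_left hs]
  equation := by
    filter_upwards [hb.ae_eq] with ω hω v t
    rw [← hω]
    exact N.flow_solves hψ hφ hφb (b ω) v t

theorem IsStrongSolution.ae_eq_flow {hT : 0 ≤ T} (hψ : LipschitzWith Kψ ψ)
    (hφ : LipschitzWith Kφ φ) (hφb : ∀ z, |φ z| ≤ M) {N : Network V StateMark Weight}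
    {B : V → ℝ≥0 → Ω → ℝ} {b β : Ω → V → PathSpace T} (hb : IsPathVersion B P b)
    (hβ : IsStrongSolution hT ψ φ N B P β) : ∀ᵐ ω ∂P, β ω = N.flow hT ψ φ (b ω) := by
  filter_upwards [hb.ae_eq, hβ.equation] with ω hω hβω
  exact (N.flow_solves hψ hφ hφb (b ω)).unique hψ hφ hφb fun v t => by rw [hβω v t, hω v t]

end StrongSolutions

/-! ### Lévy's construction of Brownian motion -/

namespace LevyConstruction

/-- The hat function on `[0, 1]`. -/
noncomputable def hat (x : ℝ) : ℝ := max 0 (min x (1 - x))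

/-- The function `x` on `[0, 1]`, extended by constants. -/
noncomputable def ramp (x : ℝ) : ℝ := max 0 (min x 1)

/-- The Schauder functions on `[0, ∞)`. -/
noncomputable def schauder : ℕ → ℕ → ℝ → ℝ
  | 0, k, t => ramp (t - k)
  | n + 1, k, t => √(1 / 2) ^ n * hat (2 ^ n * t - k)

theorem continuous_schauder (n k : ℕ) : Continuous (schauder n k) := by
  cases n with
  | zero => exact show Continuous fun t : ℝ => max 0 (min (t - k) 1) by fun_prop
  | succ n =>
    exact show Continuous fun t : ℝ =>
      √(1 / 2) ^ n * max 0 (min (2 ^ n * t - k) (1 - (2 ^ n * t - k))) by fun_prop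

theorem hat_nonneg (x : ℝ) : 0 ≤ hat x := le_max_left _ _

theorem hat_le_one (x : ℝ) : hat x ≤ 1 := by
  refine max_le zero_le_one ?_
  rcases le_total x 1 with h | h
  · exact (min_le_left _ _).trans h
  · exact (min_le_right _ _).trans (by linarith)

theorem hat_of_nonpos {x : ℝ} (h : x ≤ 0) : hat x = 0 := max_eq_left ((min_le_left _ _).trans h)

theorem hat_of_one_le {x : ℝ} (h : 1 ≤ x) : hat x = 0 :=
  max_eq_left ((min_le_right _ _).trans (by linarith))

theorem hat_of_le_half {x : ℝ} (h0 : 0 ≤ x) (h : x ≤ 1 / 2) : hat x = x := by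
  rw [hat, min_eq_left (by linarith), max_eq_right h0]

theorem hat_of_half_le {x : ℝ} (h : 1 / 2 ≤ x) (h1 : x ≤ 1) : hat x = 1 - x := by
  rw [hat, min_eq_right (by linarith), max_eq_right (by linarith)]

theorem ramp_of_nonpos {x : ℝ} (h : x ≤ 0) : ramp x = 0 := max_eq_left ((min_le_left _ _).trans h)

theorem ramp_of_one_le {x : ℝ} (h : 1 ≤ x) : ramp x = 1 := by
  rw [ramp, min_eq_right h, max_eq_right zero_le_one]

theorem ramp_of_mem {x : ℝ} (h0 : 0 ≤ x) (h : x ≤ 1) : ramp x = x := by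
  rw [ramp, min_eq_left h, max_eq_right h0]

theorem hat_sub_eq_zero {x : ℝ} (hx : 0 ≤ x) {k : ℕ} (h : k ≠ ⌊x⌋₊) : hat (x - k) = 0 := by
  rcases lt_or_gt_of_ne h with h | h
  · have : ((k + 1 : ℕ) : ℝ) ≤ x := (Nat.cast_le.2 h).trans (Nat.floor_le hx)
    push_cast at this
    exact hat_of_one_le (by linarith)
  · have := (Nat.floor_lt hx).1 h
    exact hat_of_nonpos (by linarith)

/-- The hats of one level have disjoint supports, so only the one over the cell of `x` contributes.
-/
theorem sum_hat_mul {x : ℝ} (hx : 0 ≤ x) {N : ℕ} (hN : ⌊x⌋₊ < N) (b : ℕ → ℝ) :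
    ∑ k ∈ Finset.range N, hat (x - k) * b k = hat (x - ⌊x⌋₊) * b ⌊x⌋₊ := by
  refine Finset.sum_eq_single _ (fun k _ hk => ?_) fun h => ?_
  · rw [hat_sub_eq_zero hx hk, zero_mul]
  · exact absurd (Finset.mem_range.2 hN) h

/-- The covariance of the linear interpolation of a Gaussian random walk. -/
noncomputable def gridCov (x y : ℝ) : ℝ :=
  if ⌊x⌋₊ = ⌊y⌋₊ then ⌊x⌋₊ + (x - ⌊x⌋₊) * (y - ⌊y⌋₊) else min x y

/-- Steps completed before both points contribute one. The current step of `x` contributes a product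
of fractions if `y` is in the same cell, and the fraction of `x` if `y` is beyond it. -/
theorem sum_ramp_mul_ramp {x y : ℝ} (hx : 0 ≤ x) (hy : 0 ≤ y) {N : ℕ} (hxN : ⌊x⌋₊ < N)
    (hyN : ⌊y⌋₊ < N) :
    ∑ k ∈ Finset.range N, ramp (x - k) * ramp (y - k) = gridCov x y := by
  wlog hxy : x ≤ y generalizing x y
  · rw [show gridCov x y = gridCov y x from by
      by_cases h : ⌊x⌋₊ = ⌊y⌋₊
      · rw [gridCov, gridCov, if_pos h, if_pos h.symm, h]; ring
      · rw [gridCov, gridCov, if_neg h, if_neg (Ne.symm h), min_comm], ← this hy hx hyN hxN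
      (le_of_not_ge hxy)]
    exact Finset.sum_congr rfl fun k _ => mul_comm _ _
  have hx1 := Nat.floor_le hx
  have hx2 := Nat.lt_floor_add_one x
  have hy1 := Nat.floor_le hy
  have hy2 := Nat.lt_floor_add_one y
  have hfl : ⌊x⌋₊ ≤ ⌊y⌋₊ := Nat.floor_le_floor hxy
  have hsub : Finset.range (⌊x⌋₊ + 1) ⊆ Finset.range N := Finset.range_mono hxN
  rw [← Finset.sum_subset hsub, Finset.sum_range_succ]
  · have h1 : ∀ k ∈ Finset.range ⌊x⌋₊, ramp (x - k) * ramp (y - k) = 1 := by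
      intro k hk
      have hk' : ((k + 1 : ℕ) : ℝ) ≤ ⌊x⌋₊ := Nat.cast_le.2 (Finset.mem_range.1 hk)
      push_cast at hk'
      rw [ramp_of_one_le (by linarith), ramp_of_one_le (by linarith), one_mul]
    rw [Finset.sum_congr rfl h1, Finset.sum_const, Finset.card_range, nsmul_eq_mul, mul_one,
      ramp_of_mem (by linarith) (by linarith), gridCov]
    split_ifs with h
    · rw [← h] at hy1 hy2 ⊢
      rw [ramp_of_mem (x := y - _) (by linarith) (by linarith)]
    · have h2 : ((⌊x⌋₊ + 1 : ℕ) : ℝ) ≤ ⌊y⌋₊ := Nat.cast_le.2 (lt_of_le_of_ne hfl h)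
      push_cast at h2
      rw [ramp_of_one_le (x := y - _) (by linarith), min_eq_left hxy]
      ring
  · intro k _ hk
    have hk' : ((⌊x⌋₊ + 1 : ℕ) : ℝ) ≤ k := Nat.cast_le.2 (by simpa using hk)
    push_cast at hk'
    rw [ramp_of_nonpos (by linarith), zero_mul]

theorem floor_two_mul {x : ℝ} (hx : 0 ≤ x) :
    x < ⌊x⌋₊ + 1 / 2 ∧ ⌊2 * x⌋₊ = 2 * ⌊x⌋₊ ∨ ⌊x⌋₊ + 1 / 2 ≤ x ∧ ⌊2 * x⌋₊ = 2 * ⌊x⌋₊ + 1 := by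
  have h1 := Nat.floor_le hx
  have h2 := Nat.lt_floor_add_one x
  rcases lt_or_ge x (⌊x⌋₊ + 1 / 2) with h | h
  · refine Or.inl ⟨h, (Nat.floor_eq_iff (by linarith)).2 ⟨?_, ?_⟩⟩ <;> push_cast <;> linarith
  · refine Or.inr ⟨h, (Nat.floor_eq_iff (by linarith)).2 ⟨?_, ?_⟩⟩ <;> push_cast <;> linarith

/-- Adding independent Gaussian displacements at the midpoints refines the interpolated walk to the
half-integers; the factor `1 / 2` is Brownian scaling. Points in different cells stay in different
cells and share no hat, so both sides are then the minimum. -/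
theorem gridCov_add_sum_hat {x y : ℝ} (hx : 0 ≤ x) (hy : 0 ≤ y) {N : ℕ} (hxN : ⌊x⌋₊ < N) :
    gridCov x y + ∑ k ∈ Finset.range N, hat (x - k) * hat (y - k) =
      1 / 2 * gridCov (2 * x) (2 * y) := by
  rw [sum_hat_mul hx hxN]
  have hx1 := Nat.floor_le hx
  have hx2 := Nat.lt_floor_add_one x
  have hy1 := Nat.floor_le hy
  have hy2 := Nat.lt_floor_add_one y
  by_cases h : ⌊x⌋₊ = ⌊y⌋₊
  · rcases floor_two_mul hx with ⟨hx3, hx4⟩ | ⟨hx3, hx4⟩ <;>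
    rcases floor_two_mul hy with ⟨hy3, hy4⟩ | ⟨hy3, hy4⟩ <;>
    rw [gridCov, gridCov, if_pos h, hx4, hy4, ← h] <;>
    rw [← h] at hy1 hy2 hy3
    · rw [if_pos rfl, hat_of_le_half (by linarith) (by linarith),
        hat_of_le_half (by linarith) (by linarith)]
      push_cast
      ring
    · rw [if_neg (by omega), hat_of_le_half (by linarith) (by linarith),
        hat_of_half_le (by linarith) (by linarith), min_eq_left (by linarith)]
      ring
    · rw [if_neg (by omega), hat_of_half_le (by linarith) (by linarith),
        hat_of_le_half (by linarith) (by linarith), min_eq_right (by linarith)]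
      ring
    · rw [if_pos rfl, hat_of_half_le (by linarith) (by linarith),
        hat_of_half_le (by linarith) (by linarith)]
      push_cast
      ring
  · have h' : ⌊2 * x⌋₊ ≠ ⌊2 * y⌋₊ := by
      rcases floor_two_mul hx with ⟨-, hx4⟩ | ⟨-, hx4⟩ <;>
      rcases floor_two_mul hy with ⟨-, hy4⟩ | ⟨-, hy4⟩ <;> omega
    rw [hat_sub_eq_zero hy h, mul_zero, add_zero, gridCov, gridCov, if_neg h, if_neg h',
      ← mul_min_of_nonneg _ _ zero_le_two]
    ring

theorem abs_gridCov_sub_min_le {x y : ℝ} (hx : 0 ≤ x) (hy : 0 ≤ y) :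
    |gridCov x y - min x y| ≤ 1 := by
  rw [gridCov]
  split_ifs with h
  · have hx1 := Nat.floor_le hx
    have hx2 := Nat.lt_floor_add_one x
    have hy1 := Nat.floor_le hy
    have hy2 := Nat.lt_floor_add_one y
    rw [← h] at hy1 hy2 ⊢
    have h1 : 0 ≤ (x - ⌊x⌋₊) * (y - ⌊x⌋₊) := mul_nonneg (by linarith) (by linarith)
    have h2 : (x - ⌊x⌋₊) * (y - ⌊x⌋₊) ≤ 1 :=
      mul_le_one₀ (by linarith) (by linarith) (by linarith)
    have h3 : (⌊x⌋₊ : ℝ) ≤ min x y := le_min hx1 hy1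
    have h4 : min x y < ⌊x⌋₊ + 1 := (min_le_left _ _).trans_lt hx2
    rw [abs_le]
    constructor <;> linarith
  · simp

theorem floor_pow_mul_lt {t : ℝ} {m : ℕ} (ht : t < m) (n : ℕ) : ⌊2 ^ n * t⌋₊ < 2 ^ n * m ∨ m = 0 := by
  rcases Nat.eq_zero_or_pos m with h | h
  · exact Or.inr h
  · refine Or.inl ((Nat.floor_lt' (by positivity)).2 ?_)
    push_cast
    exact mul_lt_mul_of_pos_left ht (by positivity)

/-- The covariance of the partial sums of Lévy's series. -/
theorem sum_schauder_mul_schauder {s t : ℝ} (hs : 0 ≤ s) (ht : 0 ≤ t) {m : ℕ} (hsm : s < m)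
    (htm : t < m) (n : ℕ) :
    ∑ j ∈ Finset.range (n + 1), ∑ k ∈ Finset.range (2 ^ j * m), schauder j k s * schauder j k t =
      (1 / 2) ^ n * gridCov (2 ^ n * s) (2 ^ n * t) := by
  have hm : m ≠ 0 := by
    rintro rfl
    exact absurd hsm (by simpa using hs)
  induction n with
  | zero =>
    have h1 := (floor_pow_mul_lt hsm 0).resolve_right hm
    have h2 := (floor_pow_mul_lt htm 0).resolve_right hm
    simp only [pow_zero, one_mul] at h1 h2 ⊢
    rw [zero_add, Finset.sum_range_one, pow_zero, one_mul]
    exact sum_ramp_mul_ramp hs ht h1 h2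
  | succ n ih =>
    rw [Finset.sum_range_succ, ih]
    have h1 : ⌊2 ^ n * s⌋₊ < 2 ^ (n + 1) * m :=
      ((floor_pow_mul_lt hsm n).resolve_right hm).trans_le
        (Nat.mul_le_mul_right _ (Nat.pow_le_pow_right two_pos (Nat.le_succ n)))
    have h2 := gridCov_add_sum_hat (x := 2 ^ n * s) (y := 2 ^ n * t) (by positivity)
      (by positivity) h1
    have h3 : ∀ k, schauder (n + 1) k s * schauder (n + 1) k t =
        (1 / 2) ^ n * (hat (2 ^ n * s - k) * hat (2 ^ n * t - k)) := by
      intro k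
      have : (√(1 / 2 : ℝ)) ^ n * √(1 / 2) ^ n = (1 / 2) ^ n := by
        rw [← mul_pow, Real.mul_self_sqrt (by norm_num)]
      simp only [schauder]
      rw [← this]
      ring
    simp only [h3]
    rw [← Finset.mul_sum, ← mul_add, h2, pow_succ (2 : ℝ) n, mul_comm (2 ^ n : ℝ) 2, mul_assoc,
      mul_assoc, pow_succ]
    ring

/-- The grid covariance is within `1` of the minimum, and the minimum is invariant under the
scaling, so the error is at most `(1 / 2) ^ n`. -/
theorem tendsto_sum_schauder {s t : ℝ} (hs : 0 ≤ s) (ht : 0 ≤ t) {m : ℕ} (hsm : s < m)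
    (htm : t < m) :
    Tendsto (fun n => ∑ j ∈ Finset.range n, ∑ k ∈ Finset.range (2 ^ j * m),
      schauder j k s * schauder j k t) atTop (𝓝 (min s t)) := by
  rw [← tendsto_add_atTop_iff_nat 1]
  simp only [sum_schauder_mul_schauder hs ht hsm htm]
  rw [tendsto_iff_dist_tendsto_zero]
  refine squeeze_zero (fun _ => dist_nonneg) (fun n => ?_)
    (tendsto_pow_atTop_nhds_zero_of_lt_one (r := (1 / 2 : ℝ)) (by norm_num) (by norm_num))
  have h1 := abs_gridCov_sub_min_le (x := 2 ^ n * s) (y := 2 ^ n * t) (by positivity)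
    (by positivity)
  have h2 : (1 / 2 : ℝ) ^ n * 2 ^ n = 1 := by rw [← mul_pow]; norm_num
  have h3 : (1 / 2 : ℝ) ^ n * gridCov (2 ^ n * s) (2 ^ n * t) - min s t =
      (1 / 2) ^ n * (gridCov (2 ^ n * s) (2 ^ n * t) - min (2 ^ n * s) (2 ^ n * t)) := by
    rw [mul_sub, ← mul_min_of_nonneg _ _ (by positivity : (0 : ℝ) ≤ 2 ^ n), ← mul_assoc, h2, one_mul]
  rw [Real.dist_eq, h3, abs_mul, abs_of_pos (by positivity)]
  exact mul_le_of_le_one_right (by positivity) h1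

end LevyConstruction

/-! ### Convergence and law of Lévy's series -/

namespace LevyConstruction

theorem schauder_eq_zero {t : ℝ} (ht : 0 ≤ t) {n k : ℕ} (h : 2 ^ n * t ≤ k) :
    schauder n k t = 0 := by
  cases n with
  | zero => exact ramp_of_nonpos (by simpa using h)
  | succ n =>
    rw [schauder, hat_of_nonpos, mul_zero]
    have h1 : (2 : ℝ) ^ n * t ≤ 2 ^ (n + 1) * t :=
      mul_le_mul_of_nonneg_right (pow_le_pow_right₀ one_le_two (Nat.le_succ n)) ht
    linarith

/-- The terms of Lévy's series on `[0, m)`. -/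
noncomputable def term (ξ : ℕ × ℕ → ℝ) (m n : ℕ) (t : ℝ) : ℝ :=
  ∑ k ∈ Finset.range (2 ^ n * m), schauder n k t * ξ (n, k)

/-- The additional Schauder functions start to the right of `t`; hence the cutoff in `levySum` is
immaterial. -/
theorem term_eq_of_le (ξ : ℕ × ℕ → ℝ) {m m' : ℕ} (hm : m ≤ m') (n : ℕ) {t : ℝ} (ht : 0 ≤ t)
    (htm : t < m) : term ξ m n t = term ξ m' n t := by
  refine Finset.sum_subset (Finset.range_mono (Nat.mul_le_mul_left _ hm)) fun k _ hk => ?_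
  rw [schauder_eq_zero ht, zero_mul]
  have h1 : ((2 ^ n * m : ℕ) : ℝ) ≤ k := Nat.cast_le.2 (by simpa using hk)
  push_cast at h1
  exact le_trans (mul_le_mul_of_nonneg_left htm.le (by positivity)) h1

/-- Lévy's series with the coefficients `ξ`. -/
noncomputable def levySum (ξ : ℕ × ℕ → ℝ) (t : ℝ) : ℝ := ∑' n, term ξ (⌊t⌋₊ + 1) n t

theorem levySum_eq (ξ : ℕ × ℕ → ℝ) {m : ℕ} {t : ℝ} (ht : 0 ≤ t) (htm : t < m) :
    levySum ξ t = ∑' n, term ξ m n t :=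
  tsum_congr fun n => term_eq_of_le ξ ((Nat.floor_lt ht).2 htm) n ht
    (by exact_mod_cast Nat.lt_floor_add_one t)

/-- The growth condition on the coefficients that makes Lévy's series converge. -/
def HasGrowthBound (ξ : ℕ × ℕ → ℝ) : Prop :=
  ∃ Z : ℝ, 0 ≤ Z ∧ ∀ n k, ξ (n, k) ^ 8 ≤ Z * (2 ^ n * ((k : ℝ) + 1) ^ 2)

/-- At each positive level a single hat is active, with index below `2 ^ n * m`. Eighth powers are
high enough: the amplitude contributes `(1 / 16) ^ n` and the growth bound at most a multiple of `8
^ n`, which leaves geometric decay. -/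
theorem HasGrowthBound.exists_summable {ξ : ℕ × ℕ → ℝ} (h : HasGrowthBound ξ) (m : ℕ) :
    ∃ u : ℕ → ℝ, Summable u ∧ ∀ n (t : ℝ), 0 ≤ t → t < m → ‖term ξ m n t‖ ≤ u n := by
  obtain ⟨Z, hZ0, hZ⟩ := h
  set D : ℝ := max 1 (2 * Z * m ^ 2) with hD
  have hD1 : 1 ≤ D := le_max_left _ _
  refine ⟨fun n => Nat.casesOn n (∑ k ∈ Finset.range (2 ^ 0 * m), |ξ (0, k)|)
    fun n => D * (19 / 20) ^ n, ?_, ?_⟩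
  · rw [← summable_nat_add_iff 1]
    exact (summable_geometric_of_lt_one (by norm_num) (by norm_num)).mul_left D
  · intro n t ht htm
    have hm : m ≠ 0 := by
      rintro rfl
      exact absurd htm (by simpa using ht)
    cases n with
    | zero =>
      refine (Finset.abs_sum_le_sum_abs _ _).trans (Finset.sum_le_sum fun k _ => ?_)
      rw [abs_mul]
      refine mul_le_of_le_one_left (abs_nonneg _) ?_
      rw [schauder, ramp, abs_of_nonneg (le_max_left _ _)]
      exact max_le zero_le_one (min_le_right _ _)
    | succ n =>
      have hfl := (floor_pow_mul_lt htm n).resolve_right hm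
      set k := ⌊2 ^ n * t⌋₊ with hk
      have hterm : term ξ m (n + 1) t =
          √(1 / 2) ^ n * (hat (2 ^ n * t - k) * ξ (n + 1, k)) := by
        have hlt : k < 2 ^ (n + 1) * m :=
          hfl.trans_le (Nat.mul_le_mul_right _ (Nat.pow_le_pow_right two_pos (Nat.le_succ n)))
        rw [term, hk, ← sum_hat_mul (by positivity) hlt fun k => ξ (n + 1, k), Finset.mul_sum]
        exact Finset.sum_congr rfl fun k _ => by rw [schauder, mul_assoc]
      have hle : ‖term ξ m (n + 1) t‖ ≤ |√(1 / 2) ^ n * ξ (n + 1, k)| := by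
        rw [hterm, Real.norm_eq_abs, abs_mul, abs_mul, abs_mul,
          abs_of_nonneg (hat_nonneg _)]
        exact mul_le_mul_of_nonneg_left
          (mul_le_of_le_one_left (abs_nonneg _) (hat_le_one _)) (abs_nonneg _)
      refine hle.trans ?_
      have hk1 : ((k : ℝ) + 1) ≤ 2 ^ n * m := by exact_mod_cast hfl
      have h8 : |√(1 / 2) ^ n * ξ (n + 1, k)| ^ 8 ≤ (D * (19 / 20) ^ n) ^ 8 := by
        have e1 : (√(1 / 2 : ℝ) ^ n) ^ 8 = (1 / 16) ^ n := by
          rw [← pow_mul, mul_comm, pow_mul]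
          congr 1
          have : √(1 / 2 : ℝ) ^ 8 = (√(1 / 2) ^ 2) ^ 4 := by ring
          rw [this, Real.sq_sqrt (by norm_num)]
          norm_num
        have e2 : (1 / 16 : ℝ) ^ n * (Z * (2 ^ (n + 1) * (2 ^ n * m) ^ 2)) =
            2 * Z * m ^ 2 * (1 / 2) ^ n := by
          have h3 : (1 / 16 : ℝ) ^ n * (2 ^ n * (2 ^ n * 2 ^ n)) = (1 / 2) ^ n := by
            rw [← mul_pow, ← mul_pow, ← mul_pow]
            norm_num
          rw [← h3, pow_succ]
          ring
        have e3 : D ≤ D ^ 8 := le_self_pow₀ hD1 (by norm_num)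
        -- The ratio `19 / 20` is a convenient number below `1` whose eighth power is at least `1 /
        -- 2`.
        have e4 : (1 / 2 : ℝ) ^ n ≤ ((19 / 20) ^ n) ^ 8 := by
          rw [← pow_mul, mul_comm, pow_mul]
          exact pow_le_pow_left₀ (by norm_num) (by norm_num) n
        rw [mul_pow D, ← abs_pow, mul_pow, e1,
          abs_of_nonneg (mul_nonneg (by positivity) (Even.pow_nonneg (by decide) _))]
        calc (1 / 16 : ℝ) ^ n * ξ (n + 1, k) ^ 8
            ≤ (1 / 16) ^ n * (Z * (2 ^ (n + 1) * ((k : ℝ) + 1) ^ 2)) :=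
              mul_le_mul_of_nonneg_left (hZ _ _) (by positivity)
          _ ≤ (1 / 16) ^ n * (Z * (2 ^ (n + 1) * (2 ^ n * m) ^ 2)) := by gcongr
          _ = 2 * Z * m ^ 2 * (1 / 2) ^ n := e2
          _ ≤ D ^ 8 * ((19 / 20) ^ n) ^ 8 :=
              mul_le_mul ((le_max_right _ _).trans e3) e4 (by positivity) (by positivity)
      exact le_of_pow_le_pow_left₀ (by norm_num) (by positivity) h8

theorem HasGrowthBound.continuous_levySum {ξ : ℕ × ℕ → ℝ} (h : HasGrowthBound ξ) :
    Continuous fun t : ℝ≥0 => levySum ξ t := by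
  refine continuous_iff_continuousAt.2 fun t => ?_
  obtain ⟨u, hu, hbd⟩ := h.exists_summable (⌊t⌋₊ + 1)
  have hopen : IsOpen {s : ℝ≥0 | (s : ℝ) < (⌊t⌋₊ + 1 : ℕ)} :=
    isOpen_lt NNReal.continuous_coe continuous_const
  have hmem : t ∈ {s : ℝ≥0 | (s : ℝ) < (⌊t⌋₊ + 1 : ℕ)} := by
    have := Nat.lt_floor_add_one t
    exact_mod_cast this
  have hcont : ContinuousOn (fun s : ℝ≥0 => ∑' n, term ξ (⌊t⌋₊ + 1) n s)
      {s : ℝ≥0 | (s : ℝ) < (⌊t⌋₊ + 1 : ℕ)} := by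
    refine continuousOn_tsum (fun n => Continuous.continuousOn ?_) hu
      fun n s hs => hbd n s s.2 hs
    exact continuous_finsetSum _ fun k _ =>
      ((continuous_schauder n k).comp NNReal.continuous_coe).mul continuous_const
  refine (hcont.congr fun s hs => levySum_eq ξ s.2 hs).continuousAt (hopen.mem_nhds hmem)

theorem HasGrowthBound.tendsto_sum_term {ξ : ℕ × ℕ → ℝ} (h : HasGrowthBound ξ) {m : ℕ} {t : ℝ}
    (ht : 0 ≤ t) (htm : t < m) :
    Tendsto (fun n => ∑ j ∈ Finset.range n, term ξ m j t) atTop (𝓝 (levySum ξ t)) := by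
  obtain ⟨u, hu, hbd⟩ := h.exists_summable m
  rw [levySum_eq ξ ht htm]
  exact (Summable.of_norm_bounded hu fun n => hbd n t ht htm).hasSum.tendsto_sum_nat

/-- The law of a doubly indexed family of i.i.d. standard Gaussian variables. -/
noncomputable def gaussianFamily : Measure (ℕ × ℕ → ℝ) :=
  Measure.infinitePi fun _ => gaussianReal 0 1

instance : IsProbabilityMeasure gaussianFamily := by
  unfold gaussianFamily
  infer_instance

theorem measurePreserving_eval (p : ℕ × ℕ) :
    MeasurePreserving (fun ξ : ℕ × ℕ → ℝ => ξ p) gaussianFamily (gaussianReal 0 1) :=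
  measurePreserving_eval_infinitePi _ p

/-- The weights `w` are summable and the eighth Gaussian moment is finite, so the weighted sum of
all `ξ p ^ 8` has finite mean. Almost surely it is finite, and it then serves as `Z`. -/
theorem ae_hasGrowthBound : ∀ᵐ ξ ∂gaussianFamily, HasGrowthBound ξ := by
  set w : ℕ × ℕ → ℝ := fun p => (1 / 2) ^ p.1 * (1 / |(p.2 : ℝ) + 1| ^ (2 : ℝ)) with hw
  have hw0 : ∀ p, 0 ≤ w p := fun p => by positivity
  have hsum : Summable w :=
    (summable_geometric_of_lt_one (r := (1 / 2 : ℝ)) (by norm_num) (by norm_num)).mul_of_nonneg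
      ((Real.summable_one_div_nat_add_rpow 1 2).2 one_lt_two) (fun _ => by positivity)
      (fun _ => by positivity)
  set C : ℝ≥0∞ := ∫⁻ x, ENNReal.ofReal (x ^ 8) ∂gaussianReal 0 1 with hC
  have hCfin : C ≠ ⊤ := by
    have h1 := (memLp_id_gaussianReal (μ := 0) (v := 1) 8).integrable_norm_pow (p := 8)
      (by norm_num)
    have h2 : Integrable (fun x : ℝ => x ^ 8) (gaussianReal 0 1) := by
      refine h1.congr (Eventually.of_forall fun x => ?_)
      simp only [id_eq, Real.norm_eq_abs]
      rw [← abs_pow, abs_of_nonneg (Even.pow_nonneg (by decide) _)]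
    exact h2.lintegral_lt_top.ne
  have hmeas : ∀ p : ℕ × ℕ, Measurable fun ξ : ℕ × ℕ → ℝ =>
      ENNReal.ofReal (w p) * ENNReal.ofReal (ξ p ^ 8) := fun p => by fun_prop
  have hint : ∫⁻ ξ, ∑' p, ENNReal.ofReal (w p) * ENNReal.ofReal (ξ p ^ 8) ∂gaussianFamily ≠ ⊤ := by
    rw [lintegral_tsum fun p => (hmeas p).aemeasurable]
    have : ∀ p : ℕ × ℕ, ∫⁻ ξ, ENNReal.ofReal (w p) * ENNReal.ofReal (ξ p ^ 8) ∂gaussianFamily =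
        ENNReal.ofReal (w p) * C := by
      intro p
      rw [lintegral_const_mul _ (by fun_prop), hC, ← (measurePreserving_eval p).lintegral_comp
        (f := fun x => ENNReal.ofReal (x ^ 8)) (by fun_prop)]
    simp only [this]
    rw [ENNReal.tsum_mul_right]
    exact ENNReal.mul_ne_top hsum.tsum_ofReal_ne_top hCfin
  filter_upwards [ae_lt_top (Measurable.tsum hmeas) hint] with ξ hξ
  refine ⟨(∑' p, ENNReal.ofReal (w p) * ENNReal.ofReal (ξ p ^ 8)).toReal, ENNReal.toReal_nonneg,
    fun n k => ?_⟩
  have hle : ENNReal.ofReal (w (n, k) * ξ (n, k) ^ 8) ≤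
      ∑' p, ENNReal.ofReal (w p) * ENNReal.ofReal (ξ p ^ 8) := by
    rw [ENNReal.ofReal_mul (hw0 _)]
    exact ENNReal.le_tsum (n, k)
  rw [ENNReal.ofReal_le_iff_le_toReal hξ.ne] at hle
  have hpos : (0 : ℝ) < 2 ^ n * ((k : ℝ) + 1) ^ 2 := by positivity
  have hwv : w (n, k) = 1 / (2 ^ n * ((k : ℝ) + 1) ^ 2) := by
    simp only [hw]
    rw [abs_of_pos (by positivity), Real.rpow_two, one_div_pow, one_div_mul_one_div]
  rw [hwv, one_div_mul_eq_div, div_le_iff₀ hpos] at hle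
  exact hle

theorem integral_exp_sum (S : Finset (ℕ × ℕ)) (a : ℕ × ℕ → ℝ) :
    ∫ ξ, Complex.exp (((∑ p ∈ S, a p * ξ p : ℝ) : ℂ) * Complex.I) ∂gaussianFamily =
      Complex.exp (-((∑ p ∈ S, a p ^ 2 : ℝ) : ℂ) / 2) := by
  have hind : iIndepFun (fun p (ξ : ℕ × ℕ → ℝ) => a p * ξ p) gaussianFamily :=
    iIndepFun_infinitePi (X := fun p x => a p * x) fun p => by fun_prop
  have hchar := congrFun (iIndepFun.charFun_map_fun_finsetSum_eq_prod (s := S)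
    (X := fun p (ξ : ℕ × ℕ → ℝ) => a p * ξ p) (P := gaussianFamily)
    (fun p _ => Measurable.aemeasurable (by fun_prop))
    (hind.precomp (g := fun p : S => (p : ℕ × ℕ)) Subtype.val_injective)) 1
  rw [charFun_apply_real, integral_map (Measurable.aemeasurable (by fun_prop))
    (Measurable.aestronglyMeasurable (by fun_prop))] at hchar
  simp only [Complex.ofReal_one, one_mul] at hchar
  rw [hchar, Finset.prod_apply]
  have hp : ∀ p ∈ S, charFun (gaussianFamily.map fun ξ => a p * ξ p) 1 =
      Complex.exp (-((a p : ℂ) ^ 2) / 2) := by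
    intro p _
    rw [(gaussianReal_const_mul (measurePreserving_eval p).hasLaw (a p)).map_eq,
      charFun_gaussianReal]
    congr 1
    simp
    ring
  rw [Finset.prod_congr rfl hp, ← Complex.exp_sum]
  congr 1
  push_cast
  rw [← Finset.sum_div, Finset.sum_neg_distrib]

/-- The index set of the first `n` levels of Lévy's series on `[0, m)`. -/
def levels (m n : ℕ) : Finset (ℕ × ℕ) :=
  ((Finset.range n).sigma fun j => Finset.range (2 ^ j * m)).map
    (Equiv.sigmaEquivProd ℕ ℕ).toEmbedding

theorem sum_levels (m n : ℕ) (f : ℕ × ℕ → ℝ) :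
    ∑ p ∈ levels m n, f p =
      ∑ j ∈ Finset.range n, ∑ k ∈ Finset.range (2 ^ j * m), f (j, k) := by
  rw [levels, Finset.sum_map, Finset.sum_sigma]
  rfl

theorem measurable_levySum (t : ℝ) : Measurable fun ξ : ℕ × ℕ → ℝ => levySum ξ t :=
  Measurable.tsum fun n => by
    unfold term
    fun_prop

/-- Both laws have the same characteristic function. Partial sums of the series are finite Gaussian
sums with explicit characteristic functions. These converge to that of the series by dominated
convergence, and to the Brownian one because the variances converge to the quadratic form of `min`.
-/
theorem map_restrict_levySum (I : Finset ℝ≥0) :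
    gaussianFamily.map (fun ξ (i : I) => levySum ξ (i : ℝ≥0)) =
      BrownianReal.projectiveFamily I := by
  have hmeas : Measurable fun (ξ : ℕ × ℕ → ℝ) (i : I) => levySum ξ (i : ℝ≥0) :=
    measurable_pi_lambda _ fun i => measurable_levySum _
  have := Measure.isProbabilityMeasure_map (μ := gaussianFamily) hmeas.aemeasurable
  refine Measure.ext_of_charFunDual (funext fun L => ?_)
  obtain ⟨m, hm⟩ : ∃ m : ℕ, ∀ i : I, ((i : ℝ≥0) : ℝ) < m := by
    obtain ⟨x, hx⟩ := (Set.finite_range fun i : I => ((i : ℝ≥0) : ℝ)).bddAbove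
    obtain ⟨m, hm⟩ := exists_nat_gt x
    exact ⟨m, fun i => (hx ⟨i, rfl⟩).trans_lt hm⟩
  set c : I → ℝ := fun i => L (Pi.single i 1) with hc
  have hL : ∀ x, L x = ∑ i, c i * x i := by
    intro x
    conv_lhs => rw [← Finset.univ_sum_single x, map_sum]
    refine Finset.sum_congr rfl fun i _ => ?_
    rw [hc, ← smul_eq_mul, smul_eq_mul, mul_comm, ← smul_eq_mul, ← map_smul, ← Pi.single_smul,
      smul_eq_mul, mul_one]
  set a : ℕ × ℕ → ℝ := fun p => ∑ i, c i * schauder p.1 p.2 (i : ℝ≥0) with ha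
  have hpart : ∀ n ξ, ∑ p ∈ levels m n, a p * ξ p =
      ∑ i, c i * ∑ j ∈ Finset.range n, term ξ m j (i : ℝ≥0) := by
    intro n ξ
    have : ∀ i : I, ∑ j ∈ Finset.range n, term ξ m j (i : ℝ≥0) =
        ∑ p ∈ levels m n, schauder p.1 p.2 (i : ℝ≥0) * ξ p := fun i => by
      rw [sum_levels]
      rfl
    simp only [this, ha, Finset.mul_sum, Finset.sum_mul]
    rw [Finset.sum_comm]
    exact Finset.sum_congr rfl fun i _ => Finset.sum_congr rfl fun p _ => by ring
  have hvar : Tendsto (fun n => ∑ p ∈ levels m n, a p ^ 2) atTop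
      (𝓝 (∑ i, ∑ j, c i * c j * min ((i : ℝ≥0) : ℝ) (j : ℝ≥0))) := by
    have e : ∀ n, ∑ p ∈ levels m n, a p ^ 2 = ∑ i : I, ∑ j : I, c i * c j *
        ∑ l ∈ Finset.range n, ∑ k ∈ Finset.range (2 ^ l * m),
          schauder l k (i : ℝ≥0) * schauder l k (j : ℝ≥0) := by
      intro n
      have e1 : ∀ p, a p ^ 2 = ∑ i : I, ∑ j : I, c i * c j *
          (schauder p.1 p.2 (i : ℝ≥0) * schauder p.1 p.2 (j : ℝ≥0)) := by
        intro p
        rw [sq, ha, Finset.sum_mul_sum]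
        exact Finset.sum_congr rfl fun i _ => Finset.sum_congr rfl fun j _ => by ring
      simp only [e1]
      rw [Finset.sum_comm]
      refine Finset.sum_congr rfl fun i _ => ?_
      rw [Finset.sum_comm]
      refine Finset.sum_congr rfl fun j _ => ?_
      rw [← Finset.mul_sum, sum_levels]
    simp only [e]
    exact tendsto_finsetSum _ fun i _ => tendsto_finsetSum _ fun j _ =>
      (tendsto_sum_schauder (i : ℝ≥0).2 (j : ℝ≥0).2 (hm i) (hm j)).const_mul _
  have hlim1 : Tendsto (fun n => ∫ ξ, Complex.exp (((∑ p ∈ levels m n, a p * ξ p : ℝ) : ℂ) *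
      Complex.I) ∂gaussianFamily) atTop
      (𝓝 (charFunDual (gaussianFamily.map fun ξ (i : I) => levySum ξ (i : ℝ≥0)) L)) := by
    rw [charFunDual_apply, integral_map hmeas.aemeasurable
      (Measurable.aestronglyMeasurable (by fun_prop))]
    refine tendsto_integral_of_dominated_convergence (fun _ => 1)
      (fun n => Measurable.aestronglyMeasurable (by fun_prop)) (integrable_const _)
      (fun n => Eventually.of_forall fun ξ => (Complex.norm_exp_ofReal_mul_I _).le) ?_
    filter_upwards [ae_hasGrowthBound] with ξ hξ
    have h1 : Tendsto (fun n => ∑ p ∈ levels m n, a p * ξ p) atTop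
        (𝓝 (L fun i => levySum ξ (i : ℝ≥0))) := by
      simp only [hpart, hL]
      exact tendsto_finsetSum _ fun i _ => (hξ.tendsto_sum_term (i : ℝ≥0).2 (hm i)).const_mul _
    exact ((Complex.continuous_exp.comp
      (Complex.continuous_ofReal.mul continuous_const)).tendsto _).comp h1
  have hlim2 : Tendsto (fun n => ∫ ξ, Complex.exp (((∑ p ∈ levels m n, a p * ξ p : ℝ) : ℂ) *
      Complex.I) ∂gaussianFamily) atTop
      (𝓝 (Complex.exp (-((∑ i, ∑ j, c i * c j * min ((i : ℝ≥0) : ℝ) (j : ℝ≥0) : ℝ) : ℂ) / 2))) := by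
    simp only [integral_exp_sum]
    have hcont : Continuous fun x : ℝ => Complex.exp (-(x : ℂ) / 2) := by fun_prop
    exact (hcont.tendsto _).comp hvar
  rw [tendsto_nhds_unique hlim1 hlim2,
    IsGaussian.charFunDual_eq_of_integral_eq_zero (BrownianReal.integral_id_projectiveFamily' I)]
  have hV : Var[L; BrownianReal.projectiveFamily I] =
      ∑ i, ∑ j, c i * c j * min ((i : ℝ≥0) : ℝ) (j : ℝ≥0) := by
    have hLfun : ⇑L = fun x => ∑ i, c i * x i := funext hL
    rw [hLfun, variance_fun_sum' fun i _ => ?_]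
    · refine Finset.sum_congr rfl fun i _ => Finset.sum_congr rfl fun j _ => ?_
      rw [covariance_const_mul_left, covariance_const_mul_right,
        BrownianReal.covariance_eval_projectiveFamily]
      push_cast
      ring
    · exact (IsGaussian.hasGaussianLaw_id.eval i).memLp_two.const_mul _
  rw [hV]

end LevyConstruction

/-! ### Existence of Brownian families and their law on path space -/

open LevyConstruction in
/-- Brownian motion exists. -/
theorem exists_isBrownianReal : ∃ (Ω : Type) (_ : MeasurableSpace Ω) (P : Measure Ω)
    (X : ℝ≥0 → Ω → ℝ), IsProbabilityMeasure P ∧ (∀ t, Measurable (X t)) ∧ IsBrownianReal X P := by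
  refine ⟨ℕ × ℕ → ℝ, inferInstance, gaussianFamily, fun t ξ => levySum ξ t, inferInstance,
    fun t => measurable_levySum t, ⟨⟨fun I => ⟨?_, map_restrict_levySum I⟩⟩, ?_⟩⟩
  · exact (measurable_pi_lambda _ fun i => measurable_levySum _).aemeasurable
  · filter_upwards [ae_hasGrowthBound] with ξ hξ
    exact hξ.continuous_levySum

theorem exists_isBrownianFamily (I : Type) : ∃ (Ω : Type) (_ : MeasurableSpace Ω) (P : Measure Ω)
    (B : I → ℝ≥0 → Ω → ℝ), IsProbabilityMeasure P ∧ IsBrownianFamily B P := by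
  obtain ⟨Ω, _, P, X, hP, hXm, hX⟩ := exists_isBrownianReal
  have hpres : ∀ i : I, MeasurePreserving (Function.eval i) (Measure.infinitePi fun _ : I => P) P :=
    fun i => measurePreserving_eval_infinitePi _ i
  refine ⟨I → Ω, inferInstance, Measure.infinitePi fun _ => P, fun i t ω => X t (ω i),
    inferInstance, fun i t => (hXm t).comp (measurable_pi_apply i), fun i => ⟨⟨fun J => ?_⟩, ?_⟩,
    iIndepFun_infinitePi (X := fun _ ω t => X t ω) fun _ => measurable_pi_lambda _ hXm⟩
  · exact (hX.hasLaw J).comp (hpres i).hasLaw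
  · exact (hpres i).quasiMeasurePreserving.ae hX.cont

theorem exists_pathVersion (I : Type) [Countable I] (T : ℝ) :
    ∃ (Ω : Type) (_ : MeasurableSpace Ω) (P : Measure Ω) (_ : IsProbabilityMeasure P)
      (B : I → ℝ≥0 → Ω → ℝ) (b : Ω → I → PathSpace T),
      IsBrownianFamily B P ∧ IsPathVersion B P b := by
  obtain ⟨Ω, _, P, B, hP, hB⟩ := exists_isBrownianFamily I
  obtain ⟨b, hb⟩ := hB.exists_pathVersion T
  exact ⟨Ω, _, P, hP, B, b, hB, hb⟩

/-- The law on `C([0, T]; ℝ)^I` of a family of i.i.d. standard Brownian motions. -/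
noncomputable def wienerMeasure (I : Type) [Countable I] (T : ℝ) : Measure (I → PathSpace T) :=
  let h := exists_pathVersion I T
  letI := h.choose_spec.choose
  h.choose_spec.choose_spec.choose.map
    h.choose_spec.choose_spec.choose_spec.choose_spec.choose_spec.choose

/-- Uniqueness of the law makes the choices in `wienerMeasure` irrelevant. -/
theorem IsPathVersion.map_eq_wienerMeasure {I : Type} [Countable I] {T : ℝ} {Ω : Type*}
    [MeasurableSpace Ω] {P : Measure Ω} [IsProbabilityMeasure P] {B : I → ℝ≥0 → Ω → ℝ}
    {b : Ω → I → PathSpace T} (hb : IsPathVersion B P b) (hB : IsBrownianFamily B P) :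
    P.map b = wienerMeasure I T := by
  have h := (exists_pathVersion I T).choose_spec.choose_spec.choose_spec.choose_spec.choose_spec
  let _ := (exists_pathVersion I T).choose_spec.choose
  have := (exists_pathVersion I T).choose_spec.choose_spec.choose_spec.choose
  exact hb.map_eq hB h.choose_spec.1 h.choose_spec.2

instance (I : Type) [Countable I] (T : ℝ) : IsProbabilityMeasure (wienerMeasure I T) := by
  obtain ⟨Ω, _, P, hP, B, b, hB, hb⟩ := exists_pathVersion I T
  rw [← hb.map_eq_wienerMeasure hB]
  exact Measure.isProbabilityMeasure_map hb.measurable.aemeasurable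

/-! ### Local convergence and near-isomorphisms of balls -/

namespace RootedNetwork

attribute [instance] RootedNetwork.countable

section LocalTopology

variable {Υ Ξ : Type} [MetricSpace Υ] [MetricSpace Ξ]

theorem edist_cls (N N' : RootedNetwork Υ Ξ) : edist N.cls N'.cls = localDist N N' := rfl

theorem tendsto_cls {N : RootedNetwork Υ Ξ} {N' : ℕ → RootedNetwork Υ Ξ}
    (h : ∀ r : ℕ, ∀ δ > 0, ∀ᶠ n in atTop, Good r δ N (N' n)) :
    Tendsto (fun n => (N' n).cls) atTop (𝓝 N.cls) := by
  rw [tendsto_iff_edist_tendsto_0, ENNReal.tendsto_nhds_zero]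
  intro ε hε
  rcases eq_or_ne ε ⊤ with rfl | hε'
  · simp
  have hpos : 0 < ε.toReal := ENNReal.toReal_pos hε.ne' hε'
  obtain ⟨r, hr⟩ := exists_nat_one_div_lt (half_pos hpos)
  filter_upwards [h r _ (half_pos hpos)] with n hn
  rw [edist_comm, edist_cls]
  refine (localDist_le (half_pos hpos) hn).trans ?_
  rw [ENNReal.ofReal_le_iff_le_toReal hε', add_comm (1 : ℝ)]
  linarith

/-- Take pairs that attain the infimum in `localDist` up to `1 / (n + 1)`; both of their summands
tend to zero. -/
theorem exists_good_of_tendsto {N : RootedNetwork Υ Ξ} {N' : ℕ → RootedNetwork Υ Ξ}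
    (h : Tendsto (fun n => (N' n).cls) atTop (𝓝 N.cls)) :
    ∃ (r : ℕ → ℕ) (δ : ℕ → ℝ), Tendsto r atTop atTop ∧ Tendsto δ atTop (𝓝 0) ∧
      ∀ᶠ n in atTop, Good (r n) (δ n) N (N' n) := by
  rw [tendsto_iff_edist_tendsto_0] at h
  simp only [edist_comm _ N.cls, edist_cls] at h
  have hex : ∀ n, ∃ (r : ℕ) (δ : ℝ), localDist N (N' n) ≠ ⊤ → Good r δ N (N' n) ∧ 0 < δ ∧
      1 / (1 + (r : ℝ)) + δ ≤ (localDist N (N' n)).toReal + 1 / ((n : ℝ) + 1) := by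
    intro n
    by_cases hn : localDist N (N' n) = ⊤
    -- A dummy pair; infinite distances occur for finitely many `n` only.
    · exact ⟨0, 0, fun h => absurd hn h⟩
    have hlt : localDist N (N' n) <
        ENNReal.ofReal ((localDist N (N' n)).toReal + 1 / ((n : ℝ) + 1)) := by
      rw [ENNReal.lt_ofReal_iff_toReal_lt hn]
      exact lt_add_of_pos_right _ (by positivity)
    nth_rw 1 [localDist] at hlt
    simp only [iInf_lt_iff] at hlt
    obtain ⟨r, δ, hδ, hg, hlt⟩ := hlt
    exact ⟨r, δ, fun _ => ⟨hg, hδ, (ENNReal.ofReal_lt_ofReal_iff'.1 hlt).1.le⟩⟩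
  choose r δ hrδ using hex
  have hfin : ∀ᶠ n in atTop, localDist N (N' n) ≠ ⊤ :=
    (h.eventually_lt_const ENNReal.zero_lt_top).mono fun n hn => hn.ne
  have hbd : Tendsto (fun n : ℕ => (localDist N (N' n)).toReal + 1 / ((n : ℝ) + 1)) atTop
      (𝓝 0) := by
    have h1 := (ENNReal.tendsto_toReal ENNReal.zero_ne_top).comp h
    simpa using h1.add tendsto_one_div_add_atTop_nhds_zero_nat
  refine ⟨r, δ, ?_, ?_, hfin.mono fun n hn => (hrδ n hn).1⟩
  · rw [tendsto_atTop]
    intro k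
    have hk : (0 : ℝ) < 1 / (1 + (k : ℝ)) := by positivity
    filter_upwards [hfin, hbd.eventually_lt_const hk] with n hn hlt
    obtain ⟨_, hδ, hle⟩ := hrδ n hn
    have h1 : 1 / (1 + (r n : ℝ)) < 1 / (1 + (k : ℝ)) := by linarith
    rw [one_div_lt_one_div (by positivity) (by positivity)] at h1
    have h2 : (k : ℝ) < r n := by linarith
    exact_mod_cast h2.le
  · refine tendsto_of_tendsto_of_tendsto_of_le_of_le' tendsto_const_nhds hbd ?_ ?_
    · exact hfin.mono fun n hn => (hrδ n hn).2.1.le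
    · filter_upwards [hfin] with n hn
      obtain ⟨_, hδ, hle⟩ := hrδ n hn
      have : (0 : ℝ) < 1 / (1 + (r n : ℝ)) := by positivity
      linarith

/-- The map `e` identifies the balls of radius at most `r` up to errors less than `δ` in the
marks. -/
structure IsBallIso (r : ℕ) (δ : ℝ) (N N' : RootedNetwork Υ Ξ) (e : N.V → N'.V) : Prop where
  root : e N.root = N'.root
  bijOn : ∀ s ≤ r, Set.BijOn e (N.net.ball N.root s) (N'.net.ball N'.root s)
  adj : ∀ v ∈ N.net.ball N.root r, ∀ w ∈ N.net.ball N.root r,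
    (N.net.Adj v w ↔ N'.net.Adj (e v) (e w))
  vmark : ∀ v ∈ N.net.ball N.root r, dist (N.net.vmark v) (N'.net.vmark (e v)) < δ
  emark : ∀ v ∈ N.net.ball N.root r, ∀ w ∈ N.net.ball N.root r, ∀ (h : N.net.Adj v w)
    (h' : N'.net.Adj (e v) (e w)), dist (N.net.emark v w h) (N'.net.emark (e v) (e w) h') < δ

/-- The isomorphism is extended by the root of `N'` to a total map. Smaller balls are preserved as
well, since they are built by adjacency inside the large one. -/
theorem Good.exists_isBallIso {r : ℕ} {δ : ℝ} {N N' : RootedNetwork Υ Ξ} (h : Good r δ N N') :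
    ∃ e, IsBallIso r δ N N' e := by
  classical
  obtain ⟨f, h0, h1, h2, h3⟩ : ∃ f : N.net.ball N.root r ≃ N'.net.ball N'.root r,
      f ⟨N.root, N.net.root_mem_ball _ _⟩ = ⟨N'.root, N'.net.root_mem_ball _ _⟩ ∧
      (∀ x y : N.net.ball N.root r, N.net.Adj x y ↔ N'.net.Adj (f x) (f y)) ∧
      (∀ x : N.net.ball N.root r, dist (N.net.vmark x) (N'.net.vmark (f x)) < δ) ∧
      ∀ (x y : N.net.ball N.root r) (h : N.net.Adj x y) (h' : N'.net.Adj (f x) (f y)),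
        dist (N.net.emark x y h) (N'.net.emark (f x) (f y) h') < δ := h
  obtain ⟨e, he⟩ : ∃ e : N.V → N'.V, ∀ v (hv : v ∈ N.net.ball N.root r), e v = f ⟨v, hv⟩ :=
    ⟨fun v => if hv : v ∈ N.net.ball N.root r then f ⟨v, hv⟩ else N'.root, fun v hv => dif_pos hv⟩
  refine ⟨e, ?_, ?_, ?_, ?_, ?_⟩
  · rw [he _ (N.net.root_mem_ball _ _)]
    exact congrArg Subtype.val h0
  · intro s hs
    have hA := N.net.ball_mono N.root hs
    have hA' := N'.net.ball_mono N'.root hs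
    have m1 := map_ball (N := N.net) (N' := N'.net) (o' := N'.root) (fun x => f x) hA
      (hA (N.net.root_mem_ball _ _)) (congrArg Subtype.val h0) (fun x y => (h1 x y).1)
    have m2 := map_ball (N := N'.net) (N' := N.net) (o' := N.root) (fun x => f.symm x) hA'
      (hA' (N'.net.root_mem_ball _ _))
      (congrArg Subtype.val (f.symm_apply_eq.2 h0.symm))
      (fun x y h => (h1 _ _).2 (by simpa using h))
    refine ⟨fun v hv => ?_, fun v hv w hw hvw => ?_, fun w hw => ?_⟩
    · rw [he v (hA hv)]
      exact m1 v hv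
    · rw [he v (hA hv), he w (hA hw)] at hvw
      exact congrArg Subtype.val (f.injective (Subtype.ext hvw))
    · refine ⟨f.symm ⟨w, hA' hw⟩, m2 w hw, ?_⟩
      rw [he _ (hA (m2 w hw))]
      simp
  · intro v hv w hw
    rw [he v hv, he w hw]
    exact h1 ⟨v, hv⟩ ⟨w, hw⟩
  · intro v hv
    rw [he v hv]
    exact h2 ⟨v, hv⟩
  · intro v hv w hw h h'
    have h3' := h3 ⟨v, hv⟩ ⟨w, hw⟩ h
    simp only [← he] at h3'
    exact h3' h'

/-- The vertices of the connected component of the root. -/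
def component (N : RootedNetwork Υ Ξ) : Set N.V := ⋃ r, N.net.ball N.root r

end LocalTopology

/-! ### Convergence of networks marked with paths, and the coupling of drivers -/

section Coupling

variable {T : ℝ} {N : RootedNetwork StateMark Weight} {N' : ℕ → RootedNetwork StateMark Weight}

theorem IsBallIso.good_withPaths {N N' : RootedNetwork StateMark Weight} {r s : ℕ} {δ δ' : ℝ}
    {e : N.V → N'.V} (h : IsBallIso r δ N N' e) (hs : s ≤ r) (hδ : δ ≤ δ')
    {α : N.V → PathSpace T} {α' : N'.V → PathSpace T}
    (hα : ∀ v ∈ N.net.ball N.root s, dist (α v) (α' (e v)) < δ') :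
    Good s δ' (N.withPaths α) (N'.withPaths α') := by
  have hA := N.net.ball_mono N.root hs
  refine ⟨(h.bijOn s hs).equiv, Subtype.ext h.root,
    fun x y => h.adj x.1 (hA x.2) y.1 (hA y.2), fun x => max_lt ?_ (hα x.1 x.2), fun x y a b => ?_⟩
  · exact (le_max_left _ _).trans_lt ((h.vmark x.1 (hA x.2)).trans_le hδ)
  · exact (h.emark x.1 (hA x.2) y.1 (hA y.2) a b).trans_le hδ

theorem convergesAlong_of_isBallIso {r : ℕ → ℕ} {δ : ℕ → ℝ} {e : ∀ n, N.V → (N' n).V}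
    (hr : Tendsto r atTop atTop) (hδ : Tendsto δ atTop (𝓝 0))
    (h : ∀ᶠ n in atTop, IsBallIso (r n) (δ n) N (N' n) (e n)) :
    N.net.ConvergesAlong (fun n => (N' n).net) e N.component where
  closed v hv w hvw := by
    obtain ⟨k, hk⟩ := Set.mem_iUnion.1 hv
    exact Set.mem_iUnion.2 ⟨k + 1, (N.net.mem_ball_succ _ _ _).2 (Or.inr ⟨v, hk, hvw⟩)⟩
  adj v hv := by
    obtain ⟨k, hk⟩ := Set.mem_iUnion.1 hv
    -- Radius `k + 1` contains all neighbours of `v` and, on the other side, all neighbours of its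
    -- image.
    filter_upwards [h, hr.eventually_ge_atTop (k + 1)] with n hn hrn
    have hv' : v ∈ N.net.ball N.root (r n) := N.net.ball_mono _ ((Nat.le_succ k).trans hrn) hk
    have hnb : ∀ w, N.net.Adj v w → w ∈ N.net.ball N.root (r n) := fun w hw =>
      N.net.ball_mono _ hrn ((N.net.mem_ball_succ _ _ _).2 (Or.inr ⟨v, hk, hw⟩))
    refine ⟨(hn.bijOn _ le_rfl).injOn.mono hnb, fun w' => ⟨fun hw' => ?_, ?_⟩⟩
    · have hev := (hn.bijOn k ((Nat.le_succ k).trans hrn)).mapsTo hk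
      have hw'b : w' ∈ (N' n).net.ball (N' n).root (r n) :=
        (N' n).net.ball_mono _ hrn (((N' n).net.mem_ball_succ _ _ _).2 (Or.inr ⟨_, hev, hw'⟩))
      obtain ⟨w, hw, rfl⟩ := (hn.bijOn _ le_rfl).surjOn hw'b
      exact ⟨w, (hn.adj v hv' w hw).2 hw', rfl⟩
    · rintro ⟨w, hw, rfl⟩
      exact (hn.adj v hv' w (hnb w hw)).1 hw
  vmark v hv := by
    obtain ⟨k, hk⟩ := Set.mem_iUnion.1 hv
    rw [tendsto_iff_dist_tendsto_zero]
    refine squeeze_zero' (Eventually.of_forall fun _ => dist_nonneg) ?_ hδ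
    filter_upwards [h, hr.eventually_ge_atTop k] with n hn hrn
    rw [dist_comm]
    exact (hn.vmark v (N.net.ball_mono _ hrn hk)).le
  weight v hv w hvw := by
    obtain ⟨k, hk⟩ := Set.mem_iUnion.1 hv
    rw [tendsto_iff_dist_tendsto_zero]
    refine squeeze_zero' (Eventually.of_forall fun _ => dist_nonneg) ?_ hδ
    filter_upwards [h, hr.eventually_ge_atTop (k + 1)] with n hn hrn
    have hv' : v ∈ N.net.ball N.root (r n) := N.net.ball_mono _ ((Nat.le_succ k).trans hrn) hk
    have hw' : w ∈ N.net.ball N.root (r n) :=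
      N.net.ball_mono _ hrn ((N.net.mem_ball_succ _ _ _).2 (Or.inr ⟨v, hk, hvw⟩))
    have hvw' := (hn.adj v hv' w hw').1 hvw
    rw [dist_comm, Network.weight, Network.weight, dif_pos hvw, dif_pos hvw']
    exact (hn.emark v hv' w hw' hvw hvw').le

/-- The local distance sees finitely many vertices at a time, so convergence of the paths at each
vertex suffices. -/
theorem tendsto_cls_withPaths {r : ℕ → ℕ} {δ : ℕ → ℝ} {e : ∀ n, N.V → (N' n).V}
    (hr : Tendsto r atTop atTop) (hδ : Tendsto δ atTop (𝓝 0))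
    (h : ∀ᶠ n in atTop, IsBallIso (r n) (δ n) N (N' n) (e n))
    {α : N.V → PathSpace T} {α' : ∀ n, (N' n).V → PathSpace T}
    (hα : ∀ v ∈ N.component, Tendsto (fun n => α' n (e n v)) atTop (𝓝 (α v))) :
    Tendsto (fun n => ((N' n).withPaths (α' n)).cls) atTop (𝓝 (N.withPaths α).cls) := by
  refine tendsto_cls fun s ε hε => ?_
  have hball : ∀ᶠ n in atTop, ∀ v ∈ N.net.ball N.root s, dist (α v) (α' n (e n v)) < ε := by
    refine (eventually_all_finite (N.net.ball_finite N.root s)).2 fun v hv => ?_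
    filter_upwards [Metric.tendsto_nhds.1 (hα v (Set.mem_iUnion.2 ⟨s, hv⟩)) ε hε] with n hn
    rwa [dist_comm]
  filter_upwards [h, hball, hr.eventually_ge_atTop s, hδ.eventually_le_const hε] with n h1 h2 h3 h4
  exact h1.good_withPaths h3 h4 h2

theorem isBallIso_id (N : RootedNetwork StateMark Weight) (r : ℕ) {δ : ℝ} (hδ : 0 < δ) :
    IsBallIso r δ N N id where
  root := rfl
  bijOn _ _ := Set.bijOn_id _
  adj _ _ _ _ := Iff.rfl
  vmark v _ := by simpa using hδ
  emark v _ w _ a b := by simpa using hδ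

theorem continuous_cls_withPaths (N : RootedNetwork StateMark Weight) :
    Continuous fun α : N.V → PathSpace T => (N.withPaths α).cls := by
  refine SeqContinuous.continuous fun α' α hα => ?_
  rw [tendsto_pi_nhds] at hα
  exact tendsto_cls_withPaths (N' := fun _ => N) (e := fun _ => id) (r := fun n => n)
    (δ := fun n : ℕ => 1 / ((n : ℝ) + 1)) tendsto_id tendsto_one_div_add_atTop_nhds_zero_nat
    (Eventually.of_forall fun n => isBallIso_id N n (by positivity)) fun v _ => hα v

/-- The indices of the Brownian motions that drive `N'` can be chosen such that they agree along
`e` with those of `N`. -/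
theorem exists_driver_indices {N N' : RootedNetwork StateMark Weight} (e : N.V → N'.V)
    {A : Set N.V} (he : Set.InjOn e A) :
    ∃ g : N'.V → N.V ⊕ ℕ, Function.Injective g ∧ ∀ v ∈ A, g (e v) = Sum.inl v := by
  classical
  obtain ⟨ι, hι⟩ := exists_injective_nat N'.V
  -- Vertices outside the image of `A` take fresh motions from the summand `ℕ`; injectivity keeps
  -- the family independent.
  refine ⟨fun w => if h : ∃ v ∈ A, e v = w then Sum.inl h.choose else Sum.inr (ι w), ?_, ?_⟩
  · intro w w' hww
    by_cases h : ∃ v ∈ A, e v = w <;> by_cases h' : ∃ v ∈ A, e v = w'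
    · simp only [dif_pos h, dif_pos h', Sum.inl.injEq] at hww
      rw [← h.choose_spec.2, ← h'.choose_spec.2, hww]
    · simp [dif_pos h, dif_neg h'] at hww
    · simp [dif_neg h, dif_pos h'] at hww
    · simp only [dif_neg h, dif_neg h', Sum.inr.injEq] at hww
      exact hι hww
  · intro v hv
    have h : ∃ u ∈ A, e u = e v := ⟨v, hv, rfl⟩
    simp only [dif_pos h, Sum.inl.injEq]
    exact he h.choose_spec.1 hv h.choose_spec.2

end Coupling

end RootedNetwork

/-! ### Laws of the diffusions and their continuity -/

/-- A map into probability measures that is continuous for the weak topology is measurable. -/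
theorem MeasureTheory.ProbabilityMeasure.measurable_coe_of_continuous {X E : Type*}
    [TopologicalSpace X] [MeasurableSpace X] [BorelSpace X] [TopologicalSpace E]
    [MeasurableSpace E] [BorelSpace E] [HasOuterApproxClosed E] {Q : X → ProbabilityMeasure E}
    (hQ : Continuous Q) : Measurable fun x => (Q x : Measure E) := by
  refine Measurable.measure_of_isPiSystem_of_isProbabilityMeasure
    (BorelSpace.measurable_eq.trans borel_eq_generateFrom_isClosed) isPiSystem_isClosed
    fun F hF => ?_
  have hF : IsClosed F := hF
  -- The mass of a closed set is a limit of integrals of bounded continuous functions, each of which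
  -- depends continuously on `x`.
  refine measurable_of_tendsto_metrizable (f := fun n x => ∫⁻ y, hF.apprSeq n y ∂(Q x : Measure E))
    (fun n => ?_) (tendsto_pi_nhds.2 fun x =>
      HasOuterApproxClosed.tendsto_lintegral_apprSeq hF (Q x : Measure E))
  refine Continuous.measurable (continuous_iff_continuousAt.2 fun x => ?_)
  exact ProbabilityMeasure.tendsto_iff_forall_lintegral_tendsto.1 (hQ.tendsto x) (hF.apprSeq n)

namespace RootedNetwork

variable {T : ℝ} {ψ : ℝ × ℝ → ℝ} {φ : ℝ × ℝ × ℝ × ℝ → ℝ} {Kψ Kφ : ℝ≥0} {M : ℝ}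

theorem measurable_cls_flow {hT : 0 ≤ T} (hψ : LipschitzWith Kψ ψ) (hφ : LipschitzWith Kφ φ)
    (hφb : ∀ z, |φ z| ≤ M) (N : RootedNetwork StateMark Weight) :
    Measurable fun x : N.V → PathSpace T => (N.withPaths (N.net.flow hT ψ φ x)).cls :=
  (N.continuous_cls_withPaths.comp (N.net.continuous_flow hψ hφ hφb)).measurable

/-- The law of the class of `(N, o)` marked with the solution of its interacting diffusions. -/
noncomputable def diffusionLaw (hT : 0 ≤ T) (hψ : LipschitzWith Kψ ψ) (hφ : LipschitzWith Kφ φ)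
    (hφb : ∀ z, |φ z| ≤ M) (N : RootedNetwork StateMark Weight) :
    ProbabilityMeasure (NetworkClass (PathMark T) Weight) :=
  ⟨(wienerMeasure N.V T).map fun x => (N.withPaths (N.net.flow hT ψ φ x)).cls,
    Measure.isProbabilityMeasure_map (N.measurable_cls_flow hψ hφ hφb).aemeasurable⟩

theorem coe_diffusionLaw {Ω : Type*} [MeasurableSpace Ω] {P : Measure Ω} [IsProbabilityMeasure P]
    {hT : 0 ≤ T} (hψ : LipschitzWith Kψ ψ) (hφ : LipschitzWith Kφ φ) (hφb : ∀ z, |φ z| ≤ M)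
    (N : RootedNetwork StateMark Weight) {B : N.V → ℝ≥0 → Ω → ℝ} {b : Ω → N.V → PathSpace T}
    (hB : IsBrownianFamily B P) (hb : IsPathVersion B P b) :
    (diffusionLaw hT hψ hφ hφb N : Measure (NetworkClass (PathMark T) Weight)) =
      P.map fun ω => (N.withPaths (N.net.flow hT ψ φ (b ω))).cls := by
  change (wienerMeasure N.V T).map _ = _
  rw [← hb.map_eq_wienerMeasure hB,
    Measure.map_map (N.measurable_cls_flow hψ hφ hφb) hb.measurable]
  rfl

/-- The law of the diffusions depends continuously on the rooted network. -/
theorem tendsto_diffusionLaw {hT : 0 ≤ T} (hψ : LipschitzWith Kψ ψ) (hφ : LipschitzWith Kφ φ)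
    (hφb : ∀ z, |φ z| ≤ M) {N : RootedNetwork StateMark Weight}
    {N' : ℕ → RootedNetwork StateMark Weight}
    (h : Tendsto (fun n => (N' n).cls) atTop (𝓝 N.cls)) :
    Tendsto (fun n => diffusionLaw hT hψ hφ hφb (N' n)) atTop
      (𝓝 (diffusionLaw hT hψ hφ hφb N)) := by
  obtain ⟨r, δ, hr, hδ, hgood⟩ := exists_good_of_tendsto h
  have hcoup : ∀ n, ∃ (e : N.V → (N' n).V) (g : (N' n).V → N.V ⊕ ℕ), Function.Injective g ∧
      (Good (r n) (δ n) N (N' n) → IsBallIso (r n) (δ n) N (N' n) e ∧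
        ∀ v ∈ N.net.ball N.root (r n), g (e v) = Sum.inl v) := by
    intro n
    by_cases hn : Good (r n) (δ n) N (N' n)
    · obtain ⟨e, he⟩ := hn.exists_isBallIso
      obtain ⟨g, hg, hge⟩ := exists_driver_indices e (he.bijOn _ le_rfl).injOn
      exact ⟨e, g, hg, fun _ => ⟨he, hge⟩⟩
    · obtain ⟨g, hg, -⟩ := exists_driver_indices (N := N) (N' := N' n) (fun _ => (N' n).root)
        (Set.injOn_empty _)
      exact ⟨fun _ => (N' n).root, g, hg, fun h => absurd h hn⟩
  choose e g hg heg using hcoup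
  have hiso : ∀ᶠ n in atTop, IsBallIso (r n) (δ n) N (N' n) (e n) :=
    hgood.mono fun n hn => (heg n hn).1
  obtain ⟨Ω, _, P, hP, B, b, hB, hb⟩ := exists_pathVersion (N.V ⊕ ℕ) T
  -- For each vertex the coupled drivers eventually coincide, and stability is deterministic, so the
  -- convergence holds for every outcome.
  have hae : ∀ ω, Tendsto (fun n => ((N' n).withPaths
      ((N' n).net.flow hT ψ φ fun w => b ω (g n w))).cls) atTop
      (𝓝 (N.withPaths (N.net.flow hT ψ φ fun v => b ω (Sum.inl v))).cls) := by
    intro ω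
    refine tendsto_cls_withPaths hr hδ hiso fun v hv => ?_
    refine (convergesAlong_of_isBallIso hr hδ hiso).tendsto_flow hψ hφ hφb (fun u hu => ?_) hv
    obtain ⟨k, hk⟩ := Set.mem_iUnion.1 hu
    refine tendsto_const_nhds.congr' ?_
    filter_upwards [hgood, hr.eventually_ge_atTop k] with n hn hrn
    rw [(heg n hn).2 u (N.net.ball_mono _ hrn hk)]
  have hdist := (tendstoInDistribution_of_ae_tendsto (μ' := P) (l := atTop)
    (fun n => ((measurable_cls_flow hψ hφ hφb (N' n)).comp
      (hb.comp (g n)).measurable).aemeasurable)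
    ((measurable_cls_flow hψ hφ hφb N).comp (hb.comp Sum.inl).measurable).aemeasurable
    (Eventually.of_forall hae)).tendsto
  exact (iff_of_eq (congrArg₂ (fun (f : ℕ → ProbabilityMeasure (NetworkClass (PathMark T) Weight))
      a => Tendsto f atTop (𝓝 a))
    (funext fun n => Subtype.ext
      (coe_diffusionLaw hψ hφ hφb (N' n) (hB.comp (hg n)) (hb.comp (g n))))
    (Subtype.ext (coe_diffusionLaw hψ hφ hφb N (hB.comp Sum.inl_injective) (hb.comp Sum.inl))))).2
    hdist

/-- A constant sequence of representatives converges to every representative of the same class, and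
weak limits are unique. -/
theorem diffusionLaw_congr {hT : 0 ≤ T} (hψ : LipschitzWith Kψ ψ) (hφ : LipschitzWith Kφ φ)
    (hφb : ∀ z, |φ z| ≤ M) {N N' : RootedNetwork StateMark Weight} (h : N.cls = N'.cls) :
    diffusionLaw hT hψ hφ hφb N = diffusionLaw hT hψ hφ hφb N' := by
  have h1 : Tendsto (fun _ : ℕ => N.cls) atTop (𝓝 N'.cls) := h ▸ tendsto_const_nhds
  exact tendsto_nhds_unique tendsto_const_nhds (tendsto_diffusionLaw hψ hφ hφb h1)

theorem isDiffusionLaw_diffusionLaw {hT : 0 ≤ T} (hψ : LipschitzWith Kψ ψ)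
    (hφ : LipschitzWith Kφ φ) (hφb : ∀ z, |φ z| ≤ M) (N : RootedNetwork StateMark Weight) :
    IsDiffusionLaw.{u} hT ψ φ N.cls (diffusionLaw hT hψ hφ hφb N) := by
  intro N' hN' Ω _ P _ B hB θ hθ
  obtain ⟨b, hb⟩ := hB.exists_pathVersion T
  have hae : (fun ω => (N'.withPaths (θ ω)).cls) =ᵐ[P]
      fun ω => (N'.withPaths (N'.net.flow hT ψ φ (b ω))).cls := by
    filter_upwards [hθ.ae_eq_flow hψ hφ hφb hb] with ω hω
    rw [hω]
  refine ⟨((measurable_cls_flow hψ hφ hφb N').comp hb.measurable).aemeasurable.congr hae.symm, ?_⟩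
  rw [Measure.map_congr hae, ← coe_diffusionLaw hψ hφ hφb N' hB hb,
    diffusionLaw_congr hψ hφ hφb hN']

/-- The law of the diffusions as a function of the class of the rooted network. -/
noncomputable def classLaw (hT : 0 ≤ T) (hψ : LipschitzWith Kψ ψ) (hφ : LipschitzWith Kφ φ)
    (hφb : ∀ z, |φ z| ≤ M) :
    NetworkClass StateMark Weight → ProbabilityMeasure (NetworkClass (PathMark T) Weight) :=
  Quotient.lift (diffusionLaw hT hψ hφ hφb) fun _ _ h =>
    diffusionLaw_congr hψ hφ hφb (Quotient.sound h)

/-- The local topology comes from a pseudodistance, so it suffices to lift a convergent sequence to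
representatives. -/
theorem continuous_classLaw {hT : 0 ≤ T} (hψ : LipschitzWith Kψ ψ) (hφ : LipschitzWith Kφ φ)
    (hφb : ∀ z, |φ z| ≤ M) : Continuous (classLaw hT hψ hφ hφb) := by
  refine SeqContinuous.continuous fun x' x hx => ?_
  obtain ⟨N, rfl⟩ : ∃ N : RootedNetwork StateMark Weight, N.cls = x := Quotient.exists_rep x
  have hrep : ∀ n, ∃ N' : RootedNetwork StateMark Weight, N'.cls = x' n := fun n =>
    Quotient.exists_rep (x' n)
  choose N' hN' using hrep
  obtain rfl : (fun n => (N' n).cls) = x' := funext hN'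
  exact tendsto_diffusionLaw hψ hφ hφb hx

/-- Balls of radius at most `r` are the same in `N` and in the restricted network, by `map_ball` for
the inclusion in either direction. -/
theorem isBallIso_restrict (N : RootedNetwork StateMark Weight) (r : ℕ) {δ : ℝ} (hδ : 0 < δ)
    {e : N.V → N.net.ball N.root r} (he : ∀ v ∈ N.net.ball N.root r, (e v : N.V) = v) :
    IsBallIso r δ N (N.restrict r) e := by
  have he' : ∀ v (hv : v ∈ N.net.ball N.root r), e v = ⟨v, hv⟩ := fun v hv =>
    Subtype.ext (he v hv)
  refine ⟨he' _ _, fun s hs => ?_, fun v hv w hw => ?_, fun v hv => ?_, fun v hv w hw h h' => ?_⟩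
  · have hA := N.net.ball_mono N.root hs
    have m1 := map_ball (N := N.net) (N' := (N.restrict r).net) (o' := (N.restrict r).root)
      (A' := Set.univ) (fun x => ⟨x, trivial⟩) hA (hA (N.net.root_mem_ball _ _)) rfl
      (fun _ _ h => h)
    have m2 := map_ball (N := (N.restrict r).net) (N' := N.net) (o := (N.restrict r).root)
      (o' := N.root) (A := Set.univ) (A' := Set.univ) (fun x => ⟨x.1.1, trivial⟩)
      (Set.subset_univ ((N.restrict r).net.ball (N.restrict r).root s)) trivial rfl
      (fun _ _ h => h)
    refine ⟨fun v hv => ?_, fun v hv w hw hvw => ?_, fun w hw => ⟨w.1, m2 w hw, he' _ w.2⟩⟩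
    · rw [he' v (hA hv)]
      exact m1 v hv
    · rw [← he v (hA hv), ← he w (hA hw), hvw]
  · change _ ↔ N.net.Adj (e v) (e w)
    rw [he v hv, he w hw]
  · change dist (N.net.vmark v) (N.net.vmark (e v)) < δ
    rwa [he v hv, dist_self]
  -- The edge mark depends on a proof of adjacency, so the endpoints are generalized before they are
  -- substituted.
  · have key : ∀ (v' w' : N.V) (_ : v' = v) (_ : w' = w) (h'' : N.net.Adj v' w'),
        dist (N.net.emark v w h) (N.net.emark v' w' h'') < δ := by
      rintro v' w' rfl rfl h''
      rwa [dist_self]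
    exact key _ _ (he v hv) (he w hw) h'

/-- The finite balls around the root converge to the network. -/
theorem convergesAlong_restrict (N : RootedNetwork StateMark Weight)
    {e : ∀ r, N.V → N.net.ball N.root r}
    (he : ∀ r, ∀ v ∈ N.net.ball N.root r, (e r v : N.V) = v) :
    N.net.ConvergesAlong (fun r => N.net.induce (N.net.ball N.root r)) e N.component :=
  convergesAlong_of_isBallIso (N' := fun r => N.restrict r) (r := fun r => r) tendsto_id
    tendsto_one_div_add_atTop_nhds_zero_nat
    (Eventually.of_forall fun r => N.isBallIso_restrict r (by positivity) (he r))

theorem isNice_of_finite (N : RootedNetwork StateMark Weight) [Finite N.V] : N.IsNice := by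
  constructor
  · refine ⟨(Nat.card N.V : ℝ) + 1, by positivity, fun r _ => ?_⟩
    have h1 : ((N.net.boundary (N.net.ball N.root r)).ncard : ℝ) ≤ Nat.card N.V := by
      exact_mod_cast Set.ncard_le_card _
    have h2 : 1 ≤ Real.exp (((Nat.card N.V : ℝ) + 1) * r) := Real.one_le_exp (by positivity)
    calc _ ≤ (Nat.card N.V : ℝ) := h1
      _ ≤ (Nat.card N.V : ℝ) + 1 := by linarith
      _ ≤ _ := le_mul_of_one_le_right (by positivity) h2
  · have hfin : (Set.range fun p : {p : N.V × N.V // N.net.Adj p.1 p.2} =>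
        (N.net.emark p.1.1 p.1.2 p.2 : ℝ)).Finite := Set.finite_range _
    obtain ⟨C, hC⟩ := hfin.bddAbove
    rcases isEmpty_or_nonempty {p : N.V × N.V // N.net.Adj p.1 p.2} with hE | hE
    -- Without edges any positive bounds serve.
    · exact ⟨1, 1, one_pos, fun x y h => (hE.false ⟨(x, y), h⟩).elim⟩
    · obtain ⟨p, hp⟩ := Finite.exists_min fun p : {p : N.V × N.V // N.net.Adj p.1 p.2} =>
        (N.net.emark p.1.1 p.1.2 p.2 : ℝ)
      exact ⟨N.net.emark p.1.1 p.1.2 p.2, C, (N.net.emark p.1.1 p.1.2 p.2).2, fun x y h =>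
        ⟨hp ⟨(x, y), h⟩, hC ⟨⟨(x, y), h⟩, rfl⟩⟩⟩

end RootedNetwork

/-! ### The theorem -/

theorem theorem5p9 (T : ℝ) (hT : 0 < T) (ψ : ℝ × ℝ → ℝ) (φ : ℝ × ℝ × ℝ × ℝ → ℝ)
    (hψ : ∃ K : ℝ≥0, LipschitzWith K ψ) (hφ : ∃ K : ℝ≥0, LipschitzWith K φ)
    (hφb : ∃ M : ℝ, ∀ z, |φ z| ≤ M) :
    -- existence and uniqueness of the strong solution, and its construction from finite balls
    (∀ N : RootedNetwork StateMark Weight, N.IsNice →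
      ∀ (Ω : Type u) [MeasurableSpace Ω] (P : Measure Ω) [IsProbabilityMeasure P]
        (B : N.V → ℝ≥0 → Ω → ℝ), IsBrownianFamily B P →
      ∃ θ : Ω → N.V → PathSpace T,
        IsStrongSolution hT.le ψ φ N.net B P θ ∧
        (∀ β : Ω → N.V → PathSpace T, IsStrongSolution hT.le ψ φ N.net B P β →
          ∀ᵐ ω ∂P, ∀ v, β ω v = θ ω v) ∧
        ∃ θr : ∀ r : ℕ, Ω → N.net.ball N.root r → PathSpace T,
          (∀ r : ℕ, IsStrongSolution hT.le ψ φ (N.net.induce (N.net.ball N.root r))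
            (fun v => B v) P (θr r)) ∧
          ∀ᵐ ω ∂P, ∀ v : N.V, ∀ ε : ℝ, 0 < ε → ∃ r₀ : ℕ, ∀ r : ℕ, r₀ ≤ r →
            ∀ hv : v ∈ N.net.ball N.root r, dist (θr r ω ⟨v, hv⟩) (θ ω v) < ε) ∧
    -- finite rooted networks are nice
    finiteClasses ⊆ niceClasses ∧
    -- the continuous kernel, which on finite rooted networks is the law of the diffusions
    ∃ Θ : niceClasses → ProbabilityMeasure (NetworkClass (PathMark T) Weight),
      Continuous Θ ∧
      Measurable (fun x => (Θ x : Measure (NetworkClass (PathMark T) Weight))) ∧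
      (∀ x : niceClasses, (x : NetworkClass StateMark Weight) ∈ finiteClasses →
        IsDiffusionLaw.{u} hT.le ψ φ x (Θ x)) ∧
      ∀ x : niceClasses, IsDiffusionLaw.{u} hT.le ψ φ x (Θ x) := by
  obtain ⟨Kψ, hψ⟩ := hψ
  obtain ⟨Kφ, hφ⟩ := hφ
  obtain ⟨M, hφb⟩ := hφb
  refine ⟨fun N _ Ω _ P _ B hB => ?_, ?_, fun x => RootedNetwork.classLaw hT.le hψ hφ hφb x,
    (RootedNetwork.continuous_classLaw hψ hφ hφb).comp continuous_subtype_val, ?_, ?_, ?_⟩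
  · obtain ⟨b, hb⟩ := hB.exists_pathVersion T
    refine ⟨fun ω => N.net.flow hT.le ψ φ (b ω), isStrongSolution_flow hψ hφ hφb N.net hb,
      fun β hβ => ?_, fun r ω => (N.net.induce (N.net.ball N.root r)).flow hT.le ψ φ
        fun v => b ω v, fun r => isStrongSolution_flow hψ hφ hφb _ (hb.comp Subtype.val), ?_⟩
    · filter_upwards [hβ.ae_eq_flow hψ hφ hφb hb] with ω hω v
      rw [hω]
    · refine Eventually.of_forall fun ω v ε hε => ?_
      classical
      -- The root is a dummy value for vertices not yet in the ball; each vertex of the component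
      -- leaves this case for large `r`.
      let e : ∀ r, N.V → N.net.ball N.root r := fun r v =>
        if h : v ∈ N.net.ball N.root r then ⟨v, h⟩ else ⟨N.root, N.net.root_mem_ball _ r⟩
      have he : ∀ r v (h : v ∈ N.net.ball N.root r), e r v = ⟨v, h⟩ := fun r v h => dif_pos h
      by_cases hv : v ∈ N.component
      · have hlim := (N.convergesAlong_restrict (e := e) fun r v h => by rw [he r v h]).tendsto_flow
          hψ hφ hφb (hT := hT.le) (b := b ω) (b' := fun r w => b ω w) (fun u hu => by
            obtain ⟨k, hk⟩ := Set.mem_iUnion.1 hu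
            refine tendsto_const_nhds.congr' ?_
            filter_upwards [eventually_ge_atTop k] with r hr
            rw [he r u (N.net.ball_mono _ hr hk)]) hv
        obtain ⟨r₀, hr₀⟩ := eventually_atTop.1 (Metric.tendsto_nhds.1 hlim ε hε)
        refine ⟨r₀, fun r hr hvr => ?_⟩
        have := hr₀ r hr
        rwa [he r v hvr] at this
      -- Outside the component of the root, `v` lies in no ball and there is nothing to prove.
      · exact ⟨0, fun r _ hvr => absurd (Set.mem_iUnion.2 ⟨r, hvr⟩) hv⟩
  · rintro _ ⟨N, rfl, hN⟩
    exact ⟨N, rfl, N.isNice_of_finite⟩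
  · exact ProbabilityMeasure.measurable_coe_of_continuous
      ((RootedNetwork.continuous_classLaw hψ hφ hφb).comp continuous_subtype_val)
  · rintro ⟨_, N, rfl, _⟩ _
    exact N.isDiffusionLaw_diffusionLaw hψ hφ hφb
  · rintro ⟨_, N, rfl, _⟩
    exact N.isDiffusionLaw_diffusionLaw hψ hφ hφb
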